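/- Let $n\ge 1$ and label the vertices of a convex $(n+2)$-gon in clockwise order by the integers modulo $n+2$. Write $D_{i,j}$ for the segment joining the vertices $i$ and $j$. A triangulation $\mathcal T$ is a maximal set of pairwise noncrossing diagonals. An edge flip exchanges a diagonal of $\mathcal T$, which is a diagonal of a unique quadrilateral whose sides are diagonals of $\mathcal T$ or sides of the polygon, for the other diagonal of this quadrilateral. The flip graph has the triangulations as its vertices, two of them being adjacent if they are related by one edge flip. A triangle of $\mathcal T$ is internal if its three sides are diagonals; let $t_{\mathcal T}$ be the number of internal triangles. Let $\rho(\mathcal T)=\{D_{i-1,j-1} : D_{i,j}\in\mathcal T\}$ be the counterclockwise rotation of $\mathcal T$ by $2\pi/(n+2)$. (1) The distance from $\mathcal T$ to $\rho(\mathcal T)$ in the flip graph is exactly $n-1+t_{\mathcal T}$. (2) The following procedure, started with $\mathcal T$, always stops, whatever choices are made in it; it stops after exactly $n-1+t_{\mathcal T}$ flips, and it stops at $\rho(\mathcal T)$. Hence it performs the flips of a geodesic from $\mathcal T$ to $\rho(\mathcal T)$. The procedure. We say that $D_{v,x}$ is counterclockwise to $D_{v,w}$ (at $v$) if, going counterclockwise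 around the polygon from $v$, one meets $x$ strictly before $w$. A diagonal of the original triangulation $\mathcal T$ is unflipped as long as no flip has been performed at it. An unflipped diagonal is free if no incident diagonal of the present triangulation is counterclockwise to it. At each moment at most one internal triangle is current, and there is a list of pending internal triangles; in the beginning there is no current and no pending triangle. In the following, "internal triangle" means an internal triangle of $\mathcal T$. At each moment any one of the following flips whose condition holds may be performed. (a) Flip a free diagonal. (b) If there is no free diagonal and no current triangle: choose an internal triangle with vertices $a,b,c$ in clockwise order such that $D_{a,b}$ is unflipped and no diagonal of the present triangulation is counterclockwise to it at $b$; flip $D_{a,b}$. The triangle becomes current and $D_{a,b}$ is called its initial diagonal. (c) If there is no free diagonal, and an unflipped second or third side $D_{v,w}$ of the current triangle (that is, a side other than the initial one) has incident counterclockwise diagonals at $v$, not counting the diagonal that has resulted from the flip of the initial diagonal of the current triangle: flip the counterclockwise-most of them, $D_{v,x}$, provided it is unflipped and there is an internal triangle with vertices $x,v,y$ in clockwise order. That triangle, with initial diagonal $D_{x,v}$, becomes pending. (d) If an unflipped second or third side of the current triangle has no incident counterclockwise diagonal, not counting the diagonal that has resulted from the flip of the initial diagonal of the current triangle: flip this side.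 (e) If the second and third sides of the current triangle have been flipped: flip the diagonal that has resulted from the flip of its initial diagonal. The current triangle is then finished, and the pending triangle that became pending last, if there is one, becomes current instead. The procedure stops when none of these flips can be performed. -/

import Mathlib

namespace PolygonFlip

/-! The vertices of the `(n+2)`-gon are the elements of `Fin (n + 2)`, labelled in clockwise order
(labels are taken modulo `n + 2`).  `sbtw a b c` is the strict cyclic order: going clockwise from
`a`, the vertex `b` is met strictly before `c`.  The segment joining `i` and `j` is `s(i, j)`. -/

/-- `i` and `j` are the endpoints of a side of the polygon. -/
def IsSide {n : ℕ} (i j : Fin (n + 2)) : Prop := j = i + 1 ∨ i = j + 1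

/-- `d` is a diagonal of the polygon. -/
def IsDiagonal {n : ℕ} (d : Sym2 (Fin (n + 2))) : Prop :=
  ∃ i j, d = s(i, j) ∧ i ≠ j ∧ ¬ IsSide i j

/-- The segments `d` and `e` cross in the interior of the polygon. -/
def Crosses {n : ℕ} (d e : Sym2 (Fin (n + 2))) : Prop :=
  ∃ i j k l, d = s(i, k) ∧ e = s(j, l) ∧ sbtw i j k ∧ sbtw k l i

/-- A triangulation of the `(n+2)`-gon: a maximal set of pairwise noncrossing diagonals. -/
@[ext]
structure Triangulation (n : ℕ) where
  diagonals : Finset (Sym2 (Fin (n + 2)))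
  isDiagonal : ∀ d ∈ diagonals, IsDiagonal d
  noncrossing : ∀ d ∈ diagonals, ∀ e ∈ diagonals, ¬ Crosses d e
  maximal : ∀ d, IsDiagonal d → (∀ e ∈ diagonals, ¬ Crosses d e) → d ∈ diagonals

/-- `i` and `j` are joined by a side of the polygon or by a diagonal of `T`. -/
def Triangulation.HasEdge {n : ℕ} (T : Triangulation n) (i j : Fin (n + 2)) : Prop :=
  IsSide i j ∨ s(i, j) ∈ T.diagonals

/-- `T'` is obtained from `T` by an edge flip at `d` which produces `e`: there is a quadrilateral
`i j k l` (in clockwise order) with sides in `T`, and its diagonal `d = s(i, k)`, which belongs to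
`T`, is exchanged for its other diagonal `e = s(j, l)`. -/
def FlipsTo {n : ℕ} (T : Triangulation n) (d e : Sym2 (Fin (n + 2))) (T' : Triangulation n) :
    Prop :=
  ∃ i j k l, sbtw i j k ∧ sbtw k l i ∧
    T.HasEdge i j ∧ T.HasEdge j k ∧ T.HasEdge k l ∧ T.HasEdge l i ∧
    d = s(i, k) ∧ e = s(j, l) ∧ d ∈ T.diagonals ∧
    T'.diagonals = insert e (T.diagonals.erase d)

theorem FlipsTo.notMem {n : ℕ} {T T' : Triangulation n} {d e : Sym2 (Fin (n + 2))}
    (h : FlipsTo T d e T') : e ∉ T.diagonals := by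
  obtain ⟨i, j, k, l, h1, h2, -, -, -, -, rfl, rfl, hd, -⟩ := h
  exact fun he => T.noncrossing _ hd _ he ⟨i, j, k, l, rfl, rfl, h1, h2⟩

theorem FlipsTo.symm {n : ℕ} {T T' : Triangulation n} {d e : Sym2 (Fin (n + 2))}
    (h : FlipsTo T d e T') : FlipsTo T' e d T := by
  have hne := h.notMem
  obtain ⟨i, j, k, l, h1, h2, e1, e2, e3, e4, rfl, rfl, hd, hT'⟩ := h
  have hij : i ≠ j := by rintro rfl; exact sbtw_irrefl_left h1
  have hjk : j ≠ k := by rintro rfl; exact sbtw_irrefl_right h1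
  have hkl : k ≠ l := by rintro rfl; exact sbtw_irrefl_left h2
  have hli : l ≠ i := by rintro rfl; exact sbtw_irrefl_right h2
  have key : ∀ a b, T.HasEdge a b → s(a, b) ≠ s(i, k) → T'.HasEdge a b := by
    rintro a b (h | h) hab
    · exact Or.inl h
    · refine Or.inr ?_
      rw [hT']
      exact Finset.mem_insert_of_mem (Finset.mem_erase.2 ⟨hab, h⟩)
  refine ⟨j, k, l, i, ?_, ?_, key _ _ e2 ?_, key _ _ e3 ?_, key _ _ e4 ?_, key _ _ e1 ?_, rfl,
    Sym2.eq_swap, ?_, ?_⟩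
  · rw [Fin.sbtw_iff] at *; omega
  · rw [Fin.sbtw_iff] at *; omega
  · intro h; simp only [Sym2.eq_iff] at h; tauto
  · intro h; simp only [Sym2.eq_iff] at h; tauto
  · intro h; simp only [Sym2.eq_iff] at h; tauto
  · intro h; simp only [Sym2.eq_iff] at h; tauto
  · rw [hT']; exact Finset.mem_insert_self _ _
  · rw [hT', Finset.erase_insert (fun h => hne (Finset.mem_of_mem_erase h)),
      Finset.insert_erase hd]

/-- The flip graph of the `(n+2)`-gon. -/
def flipGraph (n : ℕ) : SimpleGraph (Triangulation n) where
  Adj T T' := ∃ d e, FlipsTo T d e T'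
  symm := ⟨fun _ _ ⟨d, e, h⟩ => ⟨e, d, h.symm⟩⟩
  loopless := ⟨fun T ⟨d, e, h⟩ => h.notMem (by
    obtain ⟨_, _, _, _, -, -, -, -, -, -, -, -, -, hT⟩ := h
    rw [hT]
    exact Finset.mem_insert_self _ _)⟩

theorem sbtw_sub_one {n : ℕ} {a b c : Fin (n + 2)} :
    sbtw (a - 1) (b - 1) (c - 1) ↔ sbtw a b c := by
  have key : ∀ x : Fin (n + 2),
      (x.val = 0 ∧ (x - 1).val = n + 1) ∨ (x.val ≠ 0 ∧ (x - 1).val = x.val - 1) := by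
    intro x
    by_cases hx : x.val = 0
    · left
      have : x = 0 := Fin.ext hx
      subst this
      simp
    · right
      refine ⟨hx, ?_⟩
      have : x ≠ 0 := fun h => hx (by simp [h])
      exact Fin.val_sub_one_of_ne_zero this
  have ha := key a
  have hb := key b
  have hc := key c
  simp only [Fin.sbtw_iff, Fin.lt_def]
  omega

theorem IsDiagonal.shift {n : ℕ} {d : Sym2 (Fin (n + 2))} (h : IsDiagonal d) (c : Fin (n + 2)) :
    IsDiagonal (d.map (· + c)) := by
  obtain ⟨i, j, rfl, hij, hs⟩ := h
  refine ⟨i + c, j + c, rfl, fun h => hij (add_right_cancel h), fun h => hs ?_⟩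
  rcases h with h | h
  · exact Or.inl (add_right_cancel (b := c) (by rw [h]; abel))
  · exact Or.inr (add_right_cancel (b := c) (by rw [h]; abel))

theorem Crosses.shift {n : ℕ} {d e : Sym2 (Fin (n + 2))} (h : Crosses d e) :
    Crosses (d.map (· + 1)) (e.map (· + 1)) := by
  obtain ⟨i, j, k, l, rfl, rfl, h1, h2⟩ := h
  refine ⟨i + 1, j + 1, k + 1, l + 1, rfl, rfl, ?_, ?_⟩
  · rw [← sbtw_sub_one]; simpa using h1
  · rw [← sbtw_sub_one]; simpa using h2

theorem Crosses.shift' {n : ℕ} {d e : Sym2 (Fin (n + 2))} (h : Crosses d e) :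
    Crosses (d.map (· - 1)) (e.map (· - 1)) := by
  obtain ⟨i, j, k, l, rfl, rfl, h1, h2⟩ := h
  exact ⟨i - 1, j - 1, k - 1, l - 1, rfl, rfl, sbtw_sub_one.2 h1, sbtw_sub_one.2 h2⟩

theorem map_sub_add {n : ℕ} (d : Sym2 (Fin (n + 2))) : (d.map (· - 1)).map (· + 1) = d := by
  simp [Sym2.map_map]

theorem map_add_sub {n : ℕ} (d : Sym2 (Fin (n + 2))) : (d.map (· + 1)).map (· - 1) = d := by
  simp [Sym2.map_map]

/-- The counterclockwise rotation of a triangulation by `2π/(n+2)`: as the labels increase in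
clockwise order, the diagonal `s(i, j)` is taken to `s(i - 1, j - 1)`. -/
def Triangulation.rotate {n : ℕ} (T : Triangulation n) : Triangulation n where
  diagonals := T.diagonals.image (Sym2.map (· - 1))
  isDiagonal := by
    intro d hd
    obtain ⟨e, he, rfl⟩ := Finset.mem_image.1 hd
    simpa only [sub_eq_add_neg] using (T.isDiagonal e he).shift (-1)
  noncrossing := by
    intro d hd e he h
    obtain ⟨d, hd', rfl⟩ := Finset.mem_image.1 hd
    obtain ⟨e, he', rfl⟩ := Finset.mem_image.1 he
    have := h.shift
    rw [map_sub_add, map_sub_add] at this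
    exact T.noncrossing d hd' e he' this
  maximal := by
    intro d hd h
    refine Finset.mem_image.2 ⟨d.map (· + 1), T.maximal _ (hd.shift 1) fun e he hc => ?_,
      map_add_sub d⟩
    have := hc.shift'
    rw [map_add_sub] at this
    exact h _ (Finset.mem_image_of_mem _ he) this

/-- The internal triangles of `T`, as sets of three vertices: all three edges are diagonals of
`T`. -/
def Triangulation.internalTriangles {n : ℕ} (T : Triangulation n) :
    Finset (Finset (Fin (n + 2))) :=
  {t ∈ Finset.univ.powersetCard 3 | ∀ i ∈ t, ∀ j ∈ t, i ≠ j → s(i, j) ∈ T.diagonals}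

/-! ### The flip procedure -/

/-- Among the segments with endpoint `v`, the segment `s(v, x)` is counterclockwise to `s(v, w)`:
going counterclockwise around the polygon from `v`, the vertex `x` is met strictly before `w`.
(So `s(v, x)` is an obstacle when the endpoint `v` of `s(v, w)` is moved counterclockwise.) -/
def CcwAt {n : ℕ} (v x w : Fin (n + 2)) : Prop := sbtw w x v

/-- `e` is incident to `d` and counterclockwise to it. -/
def IncidentCcw {n : ℕ} (e d : Sym2 (Fin (n + 2))) : Prop :=
  ∃ v x w, e = s(v, x) ∧ d = s(v, w) ∧ CcwAt v x w

/-- An internal triangle with vertices `a`, `b`, `c` in clockwise order whose initial diagonal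
`s(a, b)` has been flipped once; `moved` is the diagonal which that flip has produced. -/
structure StartedTriangle (n : ℕ) where
  a : Fin (n + 2)
  b : Fin (n + 2)
  c : Fin (n + 2)
  moved : Sym2 (Fin (n + 2))

/-- `d` is the second or the third diagonal of the triangle. -/
def StartedTriangle.IsOtherSide {n : ℕ} (t : StartedTriangle n) (d : Sym2 (Fin (n + 2))) : Prop :=
  d = s(t.b, t.c) ∨ d = s(t.a, t.c)

/-- A state of the procedure: the present triangulation, the diagonals of the original triangulation
not previously flipped, the internal triangle that is being rotated at present, and the internal
triangles that have been started meanwhile and have to be rotated later (latest first). -/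
structure State (n : ℕ) where
  tri : Triangulation n
  unflipped : Finset (Sym2 (Fin (n + 2)))
  current : Option (StartedTriangle n)
  pending : List (StartedTriangle n)

/-- The initial state of the procedure for the triangulation `T`. -/
def State.init {n : ℕ} (T : Triangulation n) : State n := ⟨T, T.diagonals, none, []⟩

/-- `d` has not been flipped previously and has no incident diagonal counterclockwise to it. -/
def State.IsFree {n : ℕ} (s : State n) (d : Sym2 (Fin (n + 2))) : Prop :=
  d ∈ s.unflipped ∧ ∀ e ∈ s.tri.diagonals, ¬ IncidentCcw e d

/-- The single edge flips that the procedure performs, for the original triangulation `T`. -/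
inductive Step {n : ℕ} (T : Triangulation n) : State n → State n → Prop
  /-- Flip a diagonal not previously flipped that has no incident counterclockwise diagonal. -/
  | free (s : State n) (d e : Sym2 (Fin (n + 2))) (T' : Triangulation n)
      (hd : s.IsFree d) (hflip : FlipsTo s.tri d e T') :
      Step T s ⟨T', s.unflipped.erase d, s.current, s.pending⟩
  /-- When no flip of the first kind is possible and no internal triangle is being rotated, choose
  an internal triangle `a b c` with a diagonal `s(a, b)` not previously flipped that has no
  counterclockwise diagonal at `b`, and flip this diagonal. -/
  | start (s : State n) (a b c : Fin (n + 2)) (e : Sym2 (Fin (n + 2))) (T' : Triangulation n)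
      (hcur : s.current = none) (hfree : ∀ d, ¬ s.IsFree d)
      (habc : sbtw a b c) (hint : {a, b, c} ∈ T.internalTriangles)
      (hab : s(a, b) ∈ s.unflipped) (hb : ∀ x, s(b, x) ∈ s.tri.diagonals → ¬ CcwAt b x a)
      (hflip : FlipsTo s.tri s(a, b) e T') :
      Step T s ⟨T', s.unflipped.erase s(a, b), some ⟨a, b, c, e⟩, s.pending⟩
  /-- When no flip of the first kind is possible and the second or third diagonal `s(v, w)` of the
  current triangle has not been flipped and has incident counterclockwise diagonals at `v` (other
  than the one which the flip of the initial diagonal of the triangle has produced), flip the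
  counterclockwise-most of them, `s(v, x)`.  It belongs to an internal triangle `x v y`, whose
  rotation is to be completed later. -/
  | obstacle (s : State n) (t : StartedTriangle n) (v w x y : Fin (n + 2))
      (e : Sym2 (Fin (n + 2))) (T' : Triangulation n)
      (hcur : s.current = some t) (hfree : ∀ d, ¬ s.IsFree d)
      (hside : t.IsOtherSide s(v, w)) (hvw : s(v, w) ∈ s.unflipped)
      (hx : CcwAt v x w) (hvx : s(v, x) ∈ s.unflipped)
      (hmost : ∀ z, s(v, z) ∈ s.tri.diagonals → s(v, z) ≠ t.moved → ¬ CcwAt v z x)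
      (hxvy : sbtw x v y) (hint : {x, v, y} ∈ T.internalTriangles)
      (hflip : FlipsTo s.tri s(v, x) e T') :
      Step T s ⟨T', s.unflipped.erase s(v, x), s.current, ⟨x, v, y, e⟩ :: s.pending⟩
  /-- When the second or third diagonal of the current triangle has not been flipped and has no
  incident counterclockwise diagonal left (other than the one which the flip of the initial diagonal
  of the triangle has produced), flip it. -/
  | side (s : State n) (t : StartedTriangle n) (d e : Sym2 (Fin (n + 2))) (T' : Triangulation n)
      (hcur : s.current = some t) (hside : t.IsOtherSide d) (hd : d ∈ s.unflipped)
      (hccw : ∀ f ∈ s.tri.diagonals, IncidentCcw f d → f = t.moved)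
      (hflip : FlipsTo s.tri d e T') :
      Step T s ⟨T', s.unflipped.erase d, s.current, s.pending⟩
  /-- When the second and third diagonals of the current triangle have been flipped, flip the
  initial diagonal a second time, and go on with the latest of the pending triangles. -/
  | finish (s : State n) (t : StartedTriangle n) (e : Sym2 (Fin (n + 2))) (T' : Triangulation n)
      (hcur : s.current = some t) (hside : ∀ d, t.IsOtherSide d → d ∉ s.unflipped)
      (hflip : FlipsTo s.tri t.moved e T') :
      Step T s ⟨T', s.unflipped, s.pending.head?, s.pending.tail⟩

/-- `Run T s p`: the procedure, started with the triangulation `T`, can reach the state `s` by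
performing the edge flips of the path `p` in the flip graph. -/
inductive Run {n : ℕ} (T : Triangulation n) : (s : State n) → (flipGraph n).Walk T s.tri → Prop
  | nil : Run T (State.init T) SimpleGraph.Walk.nil
  | snoc (s s' : State n) (p : (flipGraph n).Walk T s.tri) (hp : Run T s p) (hs : Step T s s')
      (h : (flipGraph n).Adj s.tri s'.tri) : Run T s' (p.concat h)

/-- The procedure stops in the state `s`: it has no further flip to perform. -/
def Stops {n : ℕ} (T : Triangulation n) (s : State n) : Prop := ∀ s', ¬ Step T s s'

end PolygonFlip

/-! The lower bound counts the diagonals that occur along a path from `T` to `T.rotate`. A flip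
creates one diagonal, so a path of length `m` meets at most `n - 1 + m` of them. It meets the `n -
1` diagonals of `T` and the `n - 1` of the rotation; these are disjoint, since a diagonal crosses
its own rotation. There must also be at least one extra diagonal per internal triangle. Say that a
segment cuts a triangle if it leaves a vertex through the opposite side; such a segment is neither
in `T` nor in `T.rotate`. For a nonempty set `W` of internal triangles, consider the first flip that
destroys a boundary edge of `W`. Up to then the boundary of `W` is intact, and this forces the new
diagonal to cut exactly one triangle of `W` (`existsUnique_cuts_of_quadrilateral`). Removing that
triangle and repeating yields distinct extra diagonals (`card_le_card_filter_cuts`), whence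
`le_length_of_walk`.

For the procedure, an unblocked diagonal flips onto its rotation. In an internal triangle `a b c`
the three sides block each other cyclically, and one detour breaks the cycle: `s(a, b)` goes to the
temporary `s(b - 1, c)`, `s(b, c)` to its rotation, `s(c, a)` to the rotation of `s(a, b)`, and the
temporary diagonal to the rotation of `s(c, a)`. The invariant `Inv` says that every present
diagonal is unflipped, rotated or temporary, and that the triangles under rotation are nested, so
that the temporary diagonals of pending triangles do not disturb the current one. `Inv.step`
preserves it together with the balance: flips + unflipped diagonals + triangles under rotation =
diagonals of `T` + started triangles. No triangle is started twice, so there are at most `n - 1 +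
T.internalTriangles.card` flips. `Inv.exists_step` shows that the procedure can stop only when
nothing is unflipped or temporary, hence at `T.rotate`. The lower bound then makes the count exact;
that every internal triangle gets started need not be proved separately. -/

namespace PolygonFlip

/-! ### Cyclic order, crossings and the triangles of a triangulation -/

theorem val_sub_one {n : ℕ} (x : Fin (n + 2)) :
    (x.val = 0 ∧ (x - 1).val = n + 1) ∨ (x.val ≠ 0 ∧ (x - 1).val = x.val - 1) := by
  by_cases hx : x.val = 0
  · left
    have : x = 0 := Fin.ext hx
    subst this
    simp
  · right
    refine ⟨hx, ?_⟩
    have : x ≠ 0 := fun h => hx (by simp [h])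
    exact Fin.val_sub_one_of_ne_zero this

theorem val_add_one {n : ℕ} (x : Fin (n + 2)) :
    (x.val = n + 1 ∧ (x + 1).val = 0) ∨ (x.val < n + 1 ∧ (x + 1).val = x.val + 1) := by
  have h := val_sub_one (x + 1)
  rw [add_sub_cancel_right] at h
  have hx := x.isLt
  have hy := (x + 1).isLt
  generalize x + 1 = y at *
  omega

/-- The clockwise distance from a fixed vertex serves as the measure for extremal choices and
inductions over nested arcs; `val_sub_lt_of_sbtw'` is the version with the other end of the arc
fixed. -/
theorem val_sub_lt_of_sbtw {n : ℕ} {i x j : Fin (n + 2)} (h : sbtw i x j) :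
    (x - i).val < (j - i).val := by
  have key : ∀ y : Fin (n + 2), (i.val ≤ y.val ∧ (y - i).val = y.val - i.val) ∨
      (y.val < i.val ∧ (y - i).val = n + 2 + y.val - i.val) := by
    intro y
    by_cases hy : i ≤ y
    · exact .inl ⟨hy, Fin.coe_sub_iff_le.2 hy⟩
    · exact .inr ⟨not_le.1 hy, Fin.coe_sub_iff_lt.2 (not_le.1 hy)⟩
  have h1 := key x
  have h2 := key j
  have := x.isLt
  have := j.isLt
  generalize x - i = a at *
  generalize j - i = b at *
  simp only [Fin.sbtw_iff, Fin.lt_def] at *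
  omega

/-- An empty arc expresses adjacency by cyclic order alone, so that later arguments need no
arithmetic modulo `n + 2` for sides. -/
theorem isSide_iff {n : ℕ} {i j : Fin (n + 2)} :
    IsSide i j ↔ i ≠ j ∧ ((∀ x, ¬ sbtw i x j) ∨ ∀ x, ¬ sbtw j x i) := by
  have := val_add_one i
  have := val_add_one j
  have hi := i.isLt
  have hj := j.isLt
  constructor
  · intro h
    unfold IsSide at h
    simp only [Fin.sbtw_iff, Fin.lt_def, Fin.ext_iff, ne_eq] at *
    refine ⟨by omega, ?_⟩
    rcases h with h | h
    · left; intro x; have := x.isLt; omega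
    · right; intro x; have := x.isLt; omega
  · rintro ⟨hne, h⟩
    unfold IsSide
    rcases h with h | h
    · left
      have := h (i + 1)
      simp only [Fin.sbtw_iff, Fin.lt_def, Fin.ext_iff, ne_eq] at *
      omega
    · right
      have := h (j + 1)
      simp only [Fin.sbtw_iff, Fin.lt_def, Fin.ext_iff, ne_eq] at *
      omega

theorem isSide_comm {n : ℕ} {i j : Fin (n + 2)} : IsSide i j ↔ IsSide j i := or_comm

theorem isDiagonal_mk {n : ℕ} {i j : Fin (n + 2)} :
    IsDiagonal s(i, j) ↔ i ≠ j ∧ ¬ IsSide i j := by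
  constructor
  · rintro ⟨a, b, h, h1, h2⟩
    rw [Sym2.eq_iff] at h
    rcases h with ⟨rfl, rfl⟩ | ⟨rfl, rfl⟩
    · exact ⟨h1, h2⟩
    · exact ⟨h1.symm, fun h => h2 (isSide_comm.1 h)⟩
  · rintro ⟨h1, h2⟩
    exact ⟨i, j, rfl, h1, h2⟩

theorem isDiagonal_of_sbtw {n : ℕ} {i j k l : Fin (n + 2)} (h1 : sbtw i j k) (h2 : sbtw k l i) :
    IsDiagonal s(i, k) := by
  have hne : i ≠ k := by rintro rfl; exact sbtw_irrefl_left_right h1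
  refine isDiagonal_mk.2 ⟨hne, fun h => ?_⟩
  rcases (isSide_iff.1 h).2 with h | h
  · exact h _ h1
  · exact h _ h2

theorem crosses_mk {n : ℕ} {i j k l : Fin (n + 2)} :
    Crosses s(i, k) s(j, l) ↔ (sbtw i j k ∧ sbtw k l i) ∨ (sbtw i l k ∧ sbtw k j i) := by
  constructor
  · rintro ⟨a, b, c, d, h, h', h1, h2⟩
    rw [Sym2.eq_iff] at h h'
    rcases h with ⟨rfl, rfl⟩ | ⟨rfl, rfl⟩ <;> rcases h' with ⟨rfl, rfl⟩ | ⟨rfl, rfl⟩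
    · exact .inl ⟨h1, h2⟩
    · exact .inr ⟨h1, h2⟩
    · exact .inr ⟨h2, h1⟩
    · exact .inl ⟨h2, h1⟩
  · rintro (⟨h1, h2⟩ | ⟨h1, h2⟩)
    · exact ⟨i, j, k, l, rfl, rfl, h1, h2⟩
    · exact ⟨i, l, k, j, rfl, Sym2.eq_swap, h1, h2⟩

namespace Triangulation

variable {n : ℕ} {T : Triangulation n} {i j k l : Fin (n + 2)}

theorem HasEdge.symm (h : T.HasEdge i j) : T.HasEdge j i := by
  rcases h with h | h
  · exact .inl (isSide_comm.1 h)
  · exact .inr (by rwa [Sym2.eq_swap])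

theorem hasEdge_of_mem (h : s(i, j) ∈ T.diagonals) : T.HasEdge i j := .inr h

theorem HasEdge.ne (h : T.HasEdge i j) : i ≠ j := by
  rcases h with h | h
  · exact (isSide_iff.1 h).1
  · exact (isDiagonal_mk.1 (T.isDiagonal _ h)).1

theorem HasEdge.mem (h : T.HasEdge i j) (h1 : sbtw i k j) (h2 : sbtw j l i) :
    s(i, j) ∈ T.diagonals := by
  rcases h with h | h
  · exact absurd h (isDiagonal_mk.1 (isDiagonal_of_sbtw h1 h2)).2
  · exact h

/-- Edges of a triangulation do not cross. -/
theorem HasEdge.not_cross (h : T.HasEdge i k) (h' : T.HasEdge j l) (h1 : sbtw i j k) :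
    ¬ sbtw k l i := by
  intro h2
  have h3 : sbtw j k l := by rw [Fin.sbtw_iff] at *; omega
  have h4 : sbtw l i j := by rw [Fin.sbtw_iff] at *; omega
  exact T.noncrossing _ (h.mem h1 h2) _ (h'.mem h3 h4) ⟨i, j, k, l, rfl, rfl, h1, h2⟩

theorem mem_ne (h : s(i, j) ∈ T.diagonals) : i ≠ j := (hasEdge_of_mem h).ne

theorem not_isSide_of_mem (h : s(i, j) ∈ T.diagonals) : ¬ IsSide i j :=
  (isDiagonal_mk.1 (T.isDiagonal _ h)).2

theorem ne_add_one_of_mem (h : s(i, j) ∈ T.diagonals) : j ≠ i + 1 ∧ i ≠ j + 1 :=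
  not_or.1 (not_isSide_of_mem h)

theorem hasEdge_of_forall (hne : i ≠ j) (h : ∀ p q, s(p, q) ∈ T.diagonals →
    sbtw i p j → sbtw j q i → False) : T.HasEdge i j := by
  by_cases hs : IsSide i j
  · exact .inl hs
  · refine .inr (T.maximal _ (isDiagonal_mk.2 ⟨hne, hs⟩) fun e => ?_)
    induction e with | _ p q =>
    intro he hc
    rcases crosses_mk.1 hc with ⟨h1, h2⟩ | ⟨h1, h2⟩
    · exact h p q he h1 h2
    · exact h q p (by rwa [Sym2.eq_swap]) h1 h2

/-- Every edge of a triangulation is a side of a triangle on each side which is not empty. -/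
theorem exists_apex (h : T.HasEdge i j) (h1 : sbtw i k j) :
    ∃ x, sbtw i x j ∧ T.HasEdge i x ∧ T.HasEdge x j := by
  classical
  have hi1 : sbtw i (i + 1) j := by
    have := val_add_one i
    have := i.isLt
    have := j.isLt
    have := k.isLt
    simp only [Fin.sbtw_iff, Fin.lt_def] at *
    omega
  obtain ⟨x, hx, hmax⟩ := Finset.exists_max_image
    (Finset.univ.filter fun x => sbtw i x j ∧ T.HasEdge i x) (fun x => (x - i).val)
    ⟨i + 1, by simpa using ⟨hi1, .inl (.inl rfl)⟩⟩
  simp only [Finset.mem_filter, Finset.mem_univ, true_and] at hx hmax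
  refine ⟨x, hx.1, hx.2, hasEdge_of_forall ?_ ?_⟩
  · rintro rfl; exact sbtw_irrefl_right hx.1
  · intro p q hpq h2 h3
    have hp : sbtw i p j := by have := hx.1; rw [Fin.sbtw_iff] at *; omega
    have hpq' := hasEdge_of_mem hpq
    -- A diagonal crossing `s(x, j)` can cross neither `s(i, j)` nor `s(i, x)`, so it ends at `i`
    -- and gives a farther neighbour than `x`.
    have hq : q = i := by
      have a1 := h.not_cross hpq' hp
      have a2 := hx.2.not_cross hpq'.symm
      have := hx.1
      clear hi1
      simp only [Fin.sbtw_iff] at *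
      omega
    subst hq
    refine absurd (hmax p ⟨hp, hpq'.symm⟩) (not_le.2 (val_sub_lt_of_sbtw ?_))
    have := hx.1
    clear hi1
    simp only [Fin.sbtw_iff] at *
    omega

end Triangulation
end PolygonFlip

namespace PolygonFlip

/-! ### Existence and uniqueness of flips, and the number of diagonals -/

theorem FlipsTo.mem {n : ℕ} {T T' : Triangulation n} {d e : Sym2 (Fin (n + 2))}
    (h : FlipsTo T d e T') : d ∈ T.diagonals := by
  obtain ⟨_, _, _, _, -, -, -, -, -, -, -, -, hd, -⟩ := h
  exact hd

theorem FlipsTo.diagonals_eq {n : ℕ} {T T' : Triangulation n} {d e : Sym2 (Fin (n + 2))}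
    (h : FlipsTo T d e T') : T'.diagonals = insert e (T.diagonals.erase d) := by
  obtain ⟨_, _, _, _, -, -, -, -, -, -, -, -, -, hT⟩ := h
  exact hT

theorem FlipsTo.card_eq {n : ℕ} {T T' : Triangulation n} {d e : Sym2 (Fin (n + 2))}
    (h : FlipsTo T d e T') : T'.diagonals.card = T.diagonals.card := by
  rw [h.diagonals_eq, Finset.card_insert_of_notMem
    (fun h' => h.notMem (Finset.mem_of_mem_erase h')), Finset.card_erase_add_one h.mem]

namespace Triangulation

variable {n : ℕ} {T : Triangulation n} {i j k l : Fin (n + 2)}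

theorem apex_unique {x y : Fin (n + 2)} (hx : sbtw i x j) (hy : sbtw i y j)
    (h1 : T.HasEdge i x) (h2 : T.HasEdge x j) (h3 : T.HasEdge i y) (h4 : T.HasEdge y j) :
    x = y := by
  have a1 := h1.not_cross h4
  have a2 := h3.not_cross h2
  grind [Fin.sbtw_iff]

end Triangulation

/-- The result of a flip is determined by any quadrilateral around the flipped diagonal. -/
theorem FlipsTo.eq_of_quadrilateral {n : ℕ} {T T' : Triangulation n} {e : Sym2 (Fin (n + 2))}
    {i j k l : Fin (n + 2)} (h : FlipsTo T s(i, k) e T') (h1 : sbtw i j k) (h2 : sbtw k l i)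
    (hij : T.HasEdge i j) (hjk : T.HasEdge j k) (hkl : T.HasEdge k l) (hli : T.HasEdge l i) :
    e = s(j, l) := by
  obtain ⟨a, b, c, d, g1, g2, e1, e2, e3, e4, hd, rfl, -, -⟩ := h
  rw [Sym2.eq_iff] at hd
  rcases hd with ⟨rfl, rfl⟩ | ⟨rfl, rfl⟩
  · rw [Triangulation.apex_unique h1 g1 hij hjk e1 e2,
      Triangulation.apex_unique h2 g2 hkl hli e3 e4]
  · rw [Triangulation.apex_unique h1 g2 hij hjk e3 e4,
      Triangulation.apex_unique h2 g1 hkl hli e1 e2, Sym2.eq_swap]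

namespace Triangulation

variable {n : ℕ} {T : Triangulation n} {i j k l : Fin (n + 2)}

/-- An edge that crosses one diagonal of a quadrilateral and none of its sides is the other
diagonal. -/
theorem eq_of_quadrilateral {p q : Fin (n + 2)} (h1 : sbtw i j k) (h2 : sbtw k l i)
    (hp : sbtw i p k) (hq : sbtw k q i)
    (a1 : ¬ (sbtw i p j ∧ sbtw j q i)) (a2 : ¬ (sbtw j p k ∧ sbtw k q j))
    (a3 : ¬ (sbtw k q l ∧ sbtw l p k)) (a4 : ¬ (sbtw l q i ∧ sbtw i p l)) : p = j ∧ q = l := by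
  grind [Fin.sbtw_iff]

/-- The point is maximality of the new set. A diagonal compatible with it either crosses `s(i, k)`,
and then the four sides of the quadrilateral leave only `s(j, l)`, or it crosses nothing in `T` and
is already there. -/
theorem exists_flipsTo_of_quadrilateral (h : s(i, k) ∈ T.diagonals) (h1 : sbtw i j k)
    (h2 : sbtw k l i)
    (hij : T.HasEdge i j) (hjk : T.HasEdge j k) (hkl : T.HasEdge k l) (hli : T.HasEdge l i) :
    ∃ T', FlipsTo T s(i, k) s(j, l) T' := by
  have g1 : sbtw j k l := by grind [Fin.sbtw_iff]
  have g2 : sbtw l i j := by grind [Fin.sbtw_iff]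
  have hcross : ∀ p q, s(p, q) ∈ T.diagonals → sbtw j p l → sbtw l q j → s(p, q) = s(i, k) := by
    intro p q hpq hp hq
    have hpq := hasEdge_of_mem hpq
    obtain ⟨rfl, rfl⟩ := eq_of_quadrilateral g1 g2 hp hq
      (fun ⟨x, y⟩ => hjk.not_cross hpq x y) (fun ⟨x, y⟩ => hkl.not_cross hpq x y)
      (fun ⟨x, y⟩ => hli.not_cross hpq.symm x y) (fun ⟨x, y⟩ => hij.not_cross hpq.symm x y)
    exact Sym2.eq_swap
  have hside : ∀ p q a b, T.HasEdge a b → s(a, b) ≠ s(i, k) →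
      (∀ e ∈ insert s(j, l) (T.diagonals.erase s(i, k)), ¬ Crosses s(p, q) e) →
      ¬ (sbtw a p b ∧ sbtw b q a) := by
    rintro p q a b hab hne hall ⟨hp, hq⟩
    refine hall s(a, b) (Finset.mem_insert_of_mem (Finset.mem_erase.2
      ⟨hne, hab.mem hp hq⟩)) (crosses_mk.2 ?_)
    grind [Fin.sbtw_iff]
  refine ⟨⟨insert s(j, l) (T.diagonals.erase s(i, k)), ?_, ?_, ?_⟩,
    i, j, k, l, h1, h2, hij, hjk, hkl, hli, rfl, rfl, h, rfl⟩
  · intro d hd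
    rcases Finset.mem_insert.1 hd with rfl | hd
    · exact isDiagonal_of_sbtw g1 g2
    · exact T.isDiagonal _ (Finset.mem_of_mem_erase hd)
  · have key : ∀ e ∈ T.diagonals.erase s(i, k), ¬ Crosses s(j, l) e := by
      intro e
      induction e with | _ p q =>
      intro he hc
      obtain ⟨hne, he⟩ := Finset.mem_erase.1 he
      rcases crosses_mk.1 hc with ⟨hp, hq⟩ | ⟨hp, hq⟩
      · exact hne (hcross p q he hp hq)
      · exact hne (by rw [Sym2.eq_swap]; exact hcross q p (by rwa [Sym2.eq_swap]) hp hq)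
    have hsymm : ∀ d e : Sym2 (Fin (n + 2)), Crosses d e → Crosses e d := by
      rintro d e ⟨a, b, c, d, rfl, rfl, x, y⟩
      refine crosses_mk.2 ?_
      grind [Fin.sbtw_iff]
    intro d hd e he hc
    rcases Finset.mem_insert.1 hd with rfl | hd <;> rcases Finset.mem_insert.1 he with rfl | he
    · rcases crosses_mk.1 hc with ⟨x, y⟩ | ⟨x, y⟩
      · exact sbtw_irrefl_left x
      · exact sbtw_irrefl_right x
    · exact key _ he hc
    · exact key _ hd (hsymm _ _ hc)
    · exact T.noncrossing _ (Finset.mem_of_mem_erase hd) _ (Finset.mem_of_mem_erase he) hc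
  · intro d
    induction d with | _ p q =>
    intro hd hall
    have hik : s(p, q) ≠ s(i, k) := by
      intro heq
      refine hall _ (Finset.mem_insert_self _ _) ?_
      rw [heq]
      exact ⟨i, j, k, l, rfl, rfl, h1, h2⟩
    by_cases hc : Crosses s(p, q) s(i, k)
    · have aux : ∀ p q, sbtw i p k → sbtw k q i →
          (∀ e ∈ insert s(j, l) (T.diagonals.erase s(i, k)), ¬ Crosses s(p, q) e) →
          s(p, q) = s(j, l) := by
        intro p q hp hq hall
        have ne1 : i ≠ j := hij.ne
        have ne2 : j ≠ k := hjk.ne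
        have ne3 : k ≠ l := hkl.ne
        have ne4 : l ≠ i := hli.ne
        have hall' : ∀ e ∈ insert s(j, l) (T.diagonals.erase s(i, k)), ¬ Crosses s(q, p) e := by
          rwa [Sym2.eq_swap (a := q)]
        obtain ⟨rfl, rfl⟩ := eq_of_quadrilateral h1 h2 hp hq
          (hside p q i j hij (by simp only [ne_eq, Sym2.eq_iff]; tauto) hall)
          (hside p q j k hjk (by simp only [ne_eq, Sym2.eq_iff]; tauto) hall)
          (hside q p k l hkl (by simp only [ne_eq, Sym2.eq_iff]; tauto) hall')
          (hside q p l i hli (by simp only [ne_eq, Sym2.eq_iff]; tauto) hall')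
        rfl
      refine Finset.mem_insert.2 (.inl ?_)
      rcases crosses_mk.1 hc with ⟨x, y⟩ | ⟨x, y⟩
      · rw [Sym2.eq_swap (a := p)] at hall ⊢
        exact aux q p (by grind [Fin.sbtw_iff])
          (by grind [Fin.sbtw_iff]) hall
      · exact aux p q (by grind [Fin.sbtw_iff])
          (by grind [Fin.sbtw_iff]) hall
    · refine Finset.mem_insert_of_mem (Finset.mem_erase.2 ⟨hik, T.maximal _ hd fun e he => ?_⟩)
      by_cases hei : e = s(i, k)
      · rwa [hei]
      · exact hall e (Finset.mem_insert_of_mem (Finset.mem_erase.2 ⟨hei, he⟩))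

theorem exists_sbtw_of_mem (h : s(i, k) ∈ T.diagonals) : ∃ x, sbtw i x k := by
  have h1 := not_isSide_of_mem h
  have h2 := mem_ne h
  rw [isSide_iff] at h1
  push Not at h1
  exact (h1 h2).1

theorem exists_flipsTo {d : Sym2 (Fin (n + 2))} (h : d ∈ T.diagonals) :
    ∃ e T', FlipsTo T d e T' := by
  induction d with | _ i k =>
  have h' : s(k, i) ∈ T.diagonals := by rwa [Sym2.eq_swap]
  obtain ⟨x, hx⟩ := exists_sbtw_of_mem h
  obtain ⟨y, hy⟩ := exists_sbtw_of_mem h'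
  obtain ⟨j, h1, h2, h3⟩ := exists_apex (hasEdge_of_mem h) hx
  obtain ⟨l, h4, h5, h6⟩ := exists_apex (hasEdge_of_mem h') hy
  exact ⟨_, exists_flipsTo_of_quadrilateral h h1 h4 h2 h3 h5 h6⟩

theorem card_diagonals_of_forall_mem (h : ∀ d ∈ T.diagonals, (0 : Fin (n + 2)) ∈ d) :
    T.diagonals.card = n - 1 := by
  have heq : T.diagonals =
      (Finset.univ.filter fun i : Fin (n + 2) => 2 ≤ i.val ∧ i.val ≤ n).image
        (fun i => s(0, i)) := by
    ext d
    induction d with | _ p q =>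
    simp only [Finset.mem_image, Finset.mem_filter, Finset.mem_univ, true_and]
    constructor
    · have aux : ∀ q : Fin (n + 2), s(0, q) ∈ T.diagonals → 2 ≤ q.val ∧ q.val ≤ n := by
        intro q hq
        have h1 := mem_ne hq
        have h2 := ne_add_one_of_mem hq
        have h3 := val_add_one q
        have := q.isLt
        generalize q + 1 = r at *
        simp only [Fin.ext_iff, ne_eq, zero_add, Fin.val_zero, Fin.val_one] at *
        omega
      intro hpq
      have := h _ hpq
      rw [Sym2.mem_iff] at this
      rcases this with rfl | rfl
      · exact ⟨q, aux q hpq, rfl⟩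
      · rw [Sym2.eq_swap] at hpq ⊢
        exact ⟨p, aux p hpq, rfl⟩
    · rintro ⟨i, hi, hd⟩
      rw [← hd]
      refine T.maximal _ ?_ ?_
      · have h3 := val_add_one i
        refine isDiagonal_mk.2 ⟨?_, ?_⟩
        · intro h
          simp only [← h, Fin.val_zero] at hi
          omega
        · rintro (h | h)
          · simp only [h, zero_add, Fin.val_one] at hi
            omega
          · simp only [← h, Fin.val_zero] at h3
            omega
      · intro e he hc
        have h0 := h e he
        induction e with | _ a b =>
        rw [Sym2.mem_iff] at h0
        rcases h0 with rfl | rfl <;> rcases crosses_mk.1 hc with ⟨x, y⟩ | ⟨x, y⟩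
        · exact sbtw_irrefl_left x
        · exact sbtw_irrefl_right y
        · exact sbtw_irrefl_right y
        · exact sbtw_irrefl_left x
  rw [heq, Finset.card_image_of_injective]
  · have : ((Finset.univ.filter fun i : Fin (n + 2) => 2 ≤ i.val ∧ i.val ≤ n).map
        Fin.valEmbedding) = Finset.Icc 2 n := by
      ext a
      simp only [Finset.mem_map, Finset.mem_filter, Finset.mem_univ, true_and,
        Fin.valEmbedding_apply, Finset.mem_Icc]
      constructor
      · rintro ⟨i, hi, rfl⟩; exact hi
      · intro ha; exact ⟨⟨a, by omega⟩, ha, rfl⟩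
    rw [← Finset.card_map Fin.valEmbedding, this, Nat.card_Icc]
    omega
  · intro a b hab
    simpa only [Sym2.congr_right] using hab

/-- Every triangulation other than the fan at the vertex `0` has a flip which increases the degree
of `0`. -/
theorem exists_flipsTo_zero {d : Sym2 (Fin (n + 2))} (hd : d ∈ T.diagonals)
    (h0 : (0 : Fin (n + 2)) ∉ d) :
    ∃ d e T', (0 : Fin (n + 2)) ∉ d ∧ (0 : Fin (n + 2)) ∈ e ∧ FlipsTo T d e T' := by
  classical
  let F := (Finset.univ : Finset (Fin (n + 2) × Fin (n + 2))).filter fun p =>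
    0 < p.1.val ∧ p.1.val < p.2.val ∧ s(p.1, p.2) ∈ T.diagonals
  have hF : F.Nonempty := by
    induction d with | _ p q =>
    rw [Sym2.mem_iff] at h0
    have hne := mem_ne hd
    rcases lt_or_gt_of_ne hne with hlt | hlt
    · refine ⟨(p, q), Finset.mem_filter.2 ⟨Finset.mem_univ _, ?_, hlt, hd⟩⟩
      simp only [Fin.ext_iff, Fin.val_zero] at h0 ⊢
      omega
    · refine ⟨(q, p), Finset.mem_filter.2 ⟨Finset.mem_univ _, ?_, hlt, by rwa [Sym2.eq_swap]⟩⟩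
      simp only [Fin.ext_iff, Fin.val_zero] at h0 ⊢
      omega
  -- Among the diagonals avoiding `0`, take one that cuts off a longest arc not containing `0`. The
  -- triangle behind it has apex `0`, as any other apex would give a longer such arc; its flip
  -- therefore ends at `0`.
  obtain ⟨⟨p, q⟩, hpq, hmax⟩ := Finset.exists_max_image F (fun p => p.2.val - p.1.val) hF
  simp only [F, Finset.mem_filter, Finset.mem_univ, true_and, Prod.forall] at hpq hmax
  obtain ⟨hp, hlt, hmem⟩ := hpq
  have hz : sbtw q 0 p := by
    simp only [Fin.sbtw_iff, Fin.lt_def, Fin.val_zero]; omega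
  obtain ⟨z, hz1, hz2, hz3⟩ := exists_apex (hasEdge_of_mem hmem).symm hz
  have hz0 : z = 0 := by
    by_contra hne
    have hne : z.val ≠ 0 := fun h => hne (Fin.ext h)
    simp only [Fin.sbtw_iff, Fin.lt_def, Fin.val_zero] at hz1 hz
    rcases lt_or_ge z.val p.val with h | h
    · have := hmax z q ⟨by omega, by omega, ?_⟩
      · omega
      · refine hz2.symm.mem (k := p) (l := 0) ?_ ?_ <;>
          simp only [Fin.sbtw_iff, Fin.lt_def, Fin.val_zero] <;> omega
    · have := hmax p z ⟨by omega, by omega, ?_⟩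
      · omega
      · refine hz3.symm.mem (k := q) (l := 0) ?_ ?_ <;>
          simp only [Fin.sbtw_iff, Fin.lt_def, Fin.val_zero] <;> omega
  subst hz0
  obtain ⟨x, hx⟩ := exists_sbtw_of_mem hmem
  obtain ⟨j, h1, h2, h3⟩ := exists_apex (hasEdge_of_mem hmem) hx
  obtain ⟨T', hT'⟩ := exists_flipsTo_of_quadrilateral hmem h1 hz1 h2 h3 hz2 hz3
  refine ⟨_, _, T', ?_, Sym2.mem_mk_right _ _, hT'⟩
  rw [Sym2.mem_iff]
  simp only [Fin.ext_iff, Fin.val_zero]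
  omega

/-- A triangulation of the `(n+2)`-gon has `n - 1` diagonals. -/
theorem card_diagonals (T : Triangulation n) : T.diagonals.card = n - 1 := by
  classical
  -- Flips preserve the cardinality, and they lead to the fan at `0` by decreasing the number of
  -- diagonals that avoid `0`.
  induction hm : (T.diagonals.filter fun d => (0 : Fin (n + 2)) ∉ d).card using
    Nat.strong_induction_on generalizing T with | _ m ih =>
  by_cases hall : ∀ d ∈ T.diagonals, (0 : Fin (n + 2)) ∈ d
  · exact card_diagonals_of_forall_mem hall
  · push Not at hall
    obtain ⟨d, hd, h0⟩ := hall
    obtain ⟨d, e, T', h1, h2, h3⟩ := exists_flipsTo_zero hd h0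
    rw [← h3.card_eq]
    refine ih _ ?_ T' rfl
    rw [← hm]
    refine Finset.card_lt_card (Finset.ssubset_iff_subset_ne.2 ⟨?_, ?_⟩)
    · intro f hf
      rw [Finset.mem_filter, h3.diagonals_eq, Finset.mem_insert, Finset.mem_erase] at hf
      rcases hf with ⟨rfl | hf, hf0⟩
      · exact absurd h2 hf0
      · exact Finset.mem_filter.2 ⟨hf.2, hf0⟩
    · intro heq
      have : d ∈ T'.diagonals.filter fun d => (0 : Fin (n + 2)) ∉ d := by
        rw [heq]; exact Finset.mem_filter.2 ⟨h3.mem, h1⟩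
      rw [Finset.mem_filter, h3.diagonals_eq, Finset.mem_insert, Finset.mem_erase] at this
      rcases this.1 with rfl | h
      · exact h1 h2
      · exact h.1 rfl

end Triangulation
end PolygonFlip

namespace PolygonFlip

variable {n : ℕ}

/-! ### Rotation and internal triangles -/

theorem val_sub_lt_of_sbtw' {i x j : Fin (n + 2)} (h : sbtw i x j) :
    (j - x).val < (j - i).val := by
  have key : ∀ y : Fin (n + 2), (y.val ≤ j.val ∧ (j - y).val = j.val - y.val) ∨
      (j.val < y.val ∧ (j - y).val = n + 2 + j.val - y.val) := by
    intro y
    by_cases hy : y ≤ j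
    · exact .inl ⟨hy, Fin.coe_sub_iff_le.2 hy⟩
    · exact .inr ⟨not_le.1 hy, Fin.coe_sub_iff_lt.2 (not_le.1 hy)⟩
  have h1 := key x
  have h2 := key i
  have := x.isLt
  have := i.isLt
  generalize j - x = a at *
  generalize j - i = b at *
  simp only [Fin.sbtw_iff, Fin.lt_def] at *
  omega

theorem sbtw_sub_one_left {x y : Fin (n + 2)} (h : y ≠ x) (h' : y ≠ x - 1) :
    sbtw (x - 1) x y := by
  have hx := val_sub_one x
  have := x.isLt
  have := y.isLt
  generalize x - 1 = z at *
  simp only [Fin.sbtw_iff, Fin.lt_def, Fin.ext_iff, ne_eq] at *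
  omega

namespace Triangulation

variable {T : Triangulation n}

theorem mem_rotate {i j : Fin (n + 2)} :
    s(i - 1, j - 1) ∈ T.rotate.diagonals ↔ s(i, j) ∈ T.diagonals := by
  constructor
  · intro h
    obtain ⟨d, hd, he⟩ := Finset.mem_image.1 h
    have : d = s(i, j) := by
      have := congrArg (Sym2.map (· + 1)) he
      rw [map_sub_add] at this
      simpa using this
    rwa [← this]
  · intro h
    exact Finset.mem_image.2 ⟨_, h, rfl⟩

theorem mem_rotate' {i j : Fin (n + 2)} :
    s(i, j) ∈ T.rotate.diagonals ↔ s(i + 1, j + 1) ∈ T.diagonals := by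
  have := mem_rotate (T := T) (i := i + 1) (j := j + 1)
  rwa [add_sub_cancel_right, add_sub_cancel_right] at this

/-- A diagonal crosses its own rotation, which belongs to `T.rotate`. -/
theorem notMem_rotate {d : Sym2 (Fin (n + 2))} (hd : d ∈ T.diagonals) :
    d ∉ T.rotate.diagonals := by
  induction d with | _ i j =>
  intro h
  have h' := hasEdge_of_mem (mem_rotate.2 hd)
  have h1 := mem_ne hd
  have h2 := ne_add_one_of_mem hd
  have h3 := sbtw_sub_one_left (x := i) (y := j) h1.symm (fun h => h2.2 (by rw [h]; simp))
  have h4 := sbtw_sub_one_left (x := j) (y := i - 1) (fun h => h2.2 (by rw [← h]; simp))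
    (fun h => h1 (by simpa using h))
  refine (hasEdge_of_mem h).not_cross h'.symm ?_ (l := i - 1) ?_
  · have h5 := sbtw_sub_one_left (x := j) (y := i) h1 (fun h => h2.1 (by rw [h]; simp))
    grind [Fin.sbtw_iff]
  · grind [Fin.sbtw_iff]

theorem mem_internalTriangles {a b c : Fin (n + 2)} (h : sbtw a b c) :
    {a, b, c} ∈ T.internalTriangles ↔
      s(a, b) ∈ T.diagonals ∧ s(b, c) ∈ T.diagonals ∧ s(c, a) ∈ T.diagonals := by
  have h1 : a ≠ b := by rintro rfl; exact sbtw_irrefl_left h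
  have h2 : b ≠ c := by rintro rfl; exact sbtw_irrefl_right h
  have h3 : c ≠ a := by rintro rfl; exact sbtw_irrefl_left_right h
  unfold internalTriangles
  rw [Finset.mem_filter, Finset.mem_powersetCard]
  constructor
  · rintro ⟨-, h⟩
    exact ⟨h a (by simp) b (by simp) h1, h b (by simp) c (by simp) h2,
      h c (by simp) a (by simp) h3⟩
  · rintro ⟨e1, e2, e3⟩
    refine ⟨⟨Finset.subset_univ _, Finset.card_eq_three.2 ⟨a, b, c, h1, h3.symm, h2, rfl⟩⟩, ?_⟩
    have e1' := e1
    have e2' := e2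
    have e3' := e3
    rw [Sym2.eq_swap] at e1' e2' e3'
    intro i hi j hj hij
    simp only [Finset.mem_insert, Finset.mem_singleton] at hi hj
    rcases hi with rfl | rfl | rfl <;> rcases hj with rfl | rfl | rfl <;> first
      | assumption
      | exact absurd rfl hij

theorem exists_of_mem_internalTriangles {t : Finset (Fin (n + 2))}
    (h : t ∈ T.internalTriangles) : ∃ a b c, sbtw a b c ∧ t = {a, b, c} := by
  unfold internalTriangles at h
  rw [Finset.mem_filter, Finset.mem_powersetCard] at h
  obtain ⟨a, b, c, h1, h2, h3, rfl⟩ := Finset.card_eq_three.1 h.1.2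
  have : sbtw a b c ∨ sbtw a c b := by
    grind [Fin.sbtw_iff]
  rcases this with h | h
  · exact ⟨a, b, c, h, rfl⟩
  · exact ⟨a, c, b, h, by ext; simp; tauto⟩

end Triangulation

/-! ### The boundary of a set of internal triangles, and what its first flip cuts -/

/-- `a`, `b`, `c` are in clockwise order the vertices of a triangle of `W`. -/
def CwMem (W : Finset (Finset (Fin (n + 2)))) (a b c : Fin (n + 2)) : Prop :=
  sbtw a b c ∧ {a, b, c} ∈ W

theorem triple_rotate (a b c : Fin (n + 2)) :
    ({a, b, c} : Finset (Fin (n + 2))) = {b, c, a} := by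
  ext; simp; tauto

theorem CwMem.rotate {W : Finset (Finset (Fin (n + 2)))} {a b c : Fin (n + 2)}
    (h : CwMem W a b c) : CwMem W b c a :=
  ⟨sbtw_cyclic_left h.1, by rw [← triple_rotate]; exact h.2⟩

/-- `s(a, b)` is a side of one triangle of `W`, which lies on its right, and of no other. -/
def IsBoundary (W : Finset (Finset (Fin (n + 2)))) (a b : Fin (n + 2)) : Prop :=
  (∃ c, CwMem W a b c) ∧ ∀ c, ¬ CwMem W b a c

/-- The segment `e` joins a vertex of the triangle `t` to a point beyond the opposite side. -/
def Cuts (t : Finset (Fin (n + 2))) (e : Sym2 (Fin (n + 2))) : Prop :=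
  ∃ p y z u, sbtw p y z ∧ t = {p, y, z} ∧ sbtw y u z ∧ e = s(p, u)

/-- Take a directed side `a → b` of a triangle of `W` with shortest clockwise arc. A second triangle
of `W` on this side would have its third vertex inside the arc and so provide a shorter one. -/
theorem exists_isBoundary {T : Triangulation n} {W : Finset (Finset (Fin (n + 2)))}
    (hW : W ⊆ T.internalTriangles) (hne : W.Nonempty) : ∃ a b, IsBoundary W a b := by
  classical
  obtain ⟨t, ht⟩ := hne
  obtain ⟨a, b, c, h, rfl⟩ := Triangulation.exists_of_mem_internalTriangles (hW ht)
  obtain ⟨⟨a, b⟩, hab, hmin⟩ := Finset.exists_min_image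
    (Finset.univ.filter fun p : Fin (n + 2) × Fin (n + 2) => ∃ c, CwMem W p.1 p.2 c)
    (fun p => (p.2 - p.1).val) ⟨(a, b), by simpa using ⟨c, h, ht⟩⟩
  simp only [Finset.mem_filter, Finset.mem_univ, true_and, Prod.forall] at hab hmin
  refine ⟨a, b, hab, fun c' hc' => ?_⟩
  refine absurd (hmin a c' ⟨b, hc'.rotate⟩) (not_le.2 (val_sub_lt_of_sbtw hc'.rotate.1))

section
variable {T S : Triangulation n} {W : Finset (Finset (Fin (n + 2)))} {a b v x : Fin (n + 2)}

theorem CwMem.mem {a b c : Fin (n + 2)} (hW : W ⊆ T.internalTriangles) (h : CwMem W a b c) :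
    s(a, b) ∈ T.diagonals :=
  ((Triangulation.mem_internalTriangles h.1).1 (hW h.2)).1

/-- If all boundary edges of `W` are in `S`, and `a b v` is a triangle of `S` on the side of
a triangle of `W` with side `s(a, b)`, then `v` is a vertex of a triangle of `W` in the direction
of `s(a, b)`. -/
theorem exists_cwMem_of_apex (hS : ∀ a b, IsBoundary W a b → s(a, b) ∈ S.diagonals)
    {c : Fin (n + 2)} (hc : CwMem W a b c) (hv : sbtw b v a)
    (hva : S.HasEdge v a) (hvb : S.HasEdge v b) :
    ∃ y z, CwMem W v y z ∧ ¬ sbtw z a y ∧ ¬ sbtw z b y := by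
  -- Walk through `W` from the triangle at `s(a, b)` towards `v`. As long as `v` is not the vertex
  -- `p`, it lies beyond one of the two sides at `p`. That side is not a boundary edge, which would
  -- be in `S` and cross `s(v, a)` or `s(v, b)`; so `W` continues beyond it, over a shorter arc.
  suffices H : ∀ m p y z, (y - z).val = m → CwMem W p y z → ¬ sbtw z a y → ¬ sbtw z b y →
      sbtw z v y → ∃ y z, CwMem W v y z ∧ ¬ sbtw z a y ∧ ¬ sbtw z b y from
    H _ c a b rfl hc.rotate.rotate sbtw_irrefl_right sbtw_irrefl_left hv
  intro m
  induction m using Nat.strong_induction_on with | _ m ih =>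
  rintro p y z rfl hp ha hb hz
  by_cases hpv : p = v
  · exact ⟨y, z, hpv ▸ hp, ha, hb⟩
  · have hpyz := hp.1
    have : sbtw p v y ∨ sbtw z v p := by clear ih; grind [Fin.sbtw_iff]
    rcases this with h | h
    · have hnb : ¬ IsBoundary W p y := fun hbd =>
        (Triangulation.hasEdge_of_mem (hS _ _ hbd)).not_cross hvb h (by
          clear ih; grind [Fin.sbtw_iff])
      obtain ⟨c', hc'⟩ : ∃ c', CwMem W y p c' := by
        by_contra hno
        push Not at hno
        exact hnb ⟨⟨z, hp⟩, hno⟩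
      refine ih _ (val_sub_lt_of_sbtw' (i := z) (x := p) (j := y) ?_) c' y p rfl
        hc'.rotate.rotate ?_ ?_ h
      all_goals clear ih; grind [Fin.sbtw_iff]
    · have hnb : ¬ IsBoundary W z p := fun hbd =>
        (Triangulation.hasEdge_of_mem (hS _ _ hbd)).not_cross hva h (by
          clear ih; grind [Fin.sbtw_iff])
      obtain ⟨c', hc'⟩ : ∃ c', CwMem W p z c' := by
        by_contra hno
        push Not at hno
        exact hnb ⟨⟨y, hp.rotate.rotate⟩, hno⟩
      refine ih _ (val_sub_lt_of_sbtw (i := z) (x := p) (j := y) ?_) c' p z rfl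
        hc'.rotate.rotate ?_ ?_ h
      all_goals clear ih; grind [Fin.sbtw_iff]

/-- If all boundary edges of `W` are in `S`, and `b a x` is a triangle of `S` on the side of
`s(a, b)` where there is no triangle of `W` with this side, then `x` is not a vertex of a triangle
of `W` in the direction of `s(a, b)`. -/
theorem not_cwMem_of_apex (hW : W ⊆ T.internalTriangles) (hab : s(a, b) ∈ T.diagonals)
    (hS : ∀ a b, IsBoundary W a b → s(a, b) ∈ S.diagonals)
    (hno : ∀ c, ¬ CwMem W b a c) (hx : sbtw a x b)
    (hxa : S.HasEdge x a) (hxb : S.HasEdge x b) (hv : sbtw b v a) {y z : Fin (n + 2)}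
    (h : CwMem W x y z) : ¬ sbtw y v z := by
  have hab := Triangulation.hasEdge_of_mem hab
  intro hyz
  -- Walk from the triangle at `x` towards `s(a, b)`. The side `s(y, z)` facing `s(a, b)` cannot be
  -- a boundary edge, which would cross `s(x, a)` or `s(x, b)`. The next triangle does not cross
  -- `s(a, b)` either, so the walk arrives at a triangle of `W` with side `s(a, b)` on the forbidden
  -- side.
  suffices H : ∀ m p y z, (z - y).val = m → CwMem W p y z → (sbtw x y b ∨ y = b) →
      (sbtw a z x ∨ z = a) → False by
    have h1 := hab.not_cross (Triangulation.hasEdge_of_mem (h.mem hW)) hx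
    have h2 := hab.not_cross (Triangulation.hasEdge_of_mem (h.rotate.rotate.mem hW)).symm hx
    have h3 := h.1
    exact H _ x y z rfl h (by grind [Fin.sbtw_iff]) (by grind [Fin.sbtw_iff])
  intro m
  induction m using Nat.strong_induction_on with | _ m ih =>
  rintro p y z rfl hp hy hz
  by_cases heq : y = b ∧ z = a
  · obtain ⟨rfl, rfl⟩ := heq
    exact hno _ hp.rotate
  have hnb : ¬ IsBoundary W y z := by
    intro hbd
    have hyz := (Triangulation.hasEdge_of_mem (hS _ _ hbd))
    have h1 := hyz.symm.not_cross hxb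
    have h2 := hyz.symm.not_cross hxa
    clear ih hS hno
    grind [Fin.sbtw_iff]
  obtain ⟨c', hc'⟩ : ∃ c', CwMem W z y c' := by
    by_contra hno
    push Not at hno
    exact hnb ⟨⟨p, hp.rotate⟩, hno⟩
  have hc1 := hc'.1
  have hcase : (sbtw y c' b ∨ c' = b) ∨ (sbtw a c' z ∨ c' = a) := by
    have h1 := hab.symm.not_cross (Triangulation.hasEdge_of_mem (hc'.rotate.mem hW)).symm
    have h2 := hab.symm.not_cross (Triangulation.hasEdge_of_mem (hc'.rotate.rotate.mem hW))
    clear ih hS hno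
    grind [Fin.sbtw_iff]
  rcases hcase with h | h
  · refine ih _ (val_sub_lt_of_sbtw' (i := y) (x := c') (j := z) hc'.rotate.1) y c' z rfl
      hc'.rotate ?_ hz
    clear ih hS hno
    grind [Fin.sbtw_iff]
  · refine ih _ (val_sub_lt_of_sbtw (i := y) (x := c') (j := z) hc'.rotate.1) z y c' rfl
      hc' hy ?_
    clear ih hS hno
    grind [Fin.sbtw_iff]

/-- The first flip of a boundary edge of `W` produces a diagonal that cuts exactly one triangle
of `W`. -/
theorem existsUnique_cuts_of_quadrilateral (hW : W ⊆ T.internalTriangles)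
    (hS : ∀ a b, IsBoundary W a b → s(a, b) ∈ S.diagonals) (hbd : IsBoundary W a b)
    (hx : sbtw a x b) (hv : sbtw b v a) (hxa : S.HasEdge x a) (hxb : S.HasEdge x b)
    (hva : S.HasEdge v a) (hvb : S.HasEdge v b) : ∃! t, t ∈ W ∧ Cuts t s(v, x) := by
  obtain ⟨⟨c, hc⟩, hno⟩ := hbd
  obtain ⟨y, z, h1, h2, h3⟩ := exists_cwMem_of_apex hS hc hv hva hvb
  have hvyz := h1.1
  have hyxz : sbtw y x z := by clear hS hno; grind [Fin.sbtw_iff]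
  refine ⟨{v, y, z}, ⟨h1.2, v, y, z, x, h1.1, rfl, hyxz, rfl⟩, ?_⟩
  rintro t ⟨ht, p, y', z', u, hp, rfl, hu, he⟩
  rw [Sym2.eq_iff] at he
  have h4 : CwMem W p y' z' := ⟨hp, ht⟩
  -- A triangle of `W` cut from `v` is unique, as two of them would have crossing sides; none is cut
  -- from `x`.
  rcases he with ⟨rfl, rfl⟩ | ⟨rfl, rfl⟩
  · have e1 := Triangulation.hasEdge_of_mem (h1.mem hW)
    have e2 := Triangulation.hasEdge_of_mem (h1.rotate.mem hW)
    have e3 := Triangulation.hasEdge_of_mem (h1.rotate.rotate.mem hW)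
    have f1 := Triangulation.hasEdge_of_mem (h4.mem hW)
    have f2 := Triangulation.hasEdge_of_mem (h4.rotate.mem hW)
    have f3 := Triangulation.hasEdge_of_mem (h4.rotate.rotate.mem hW)
    have g1 := e2.not_cross f1.symm
    have g2 := e2.not_cross f3
    have g3 := f2.not_cross e1.symm
    have g4 := f2.not_cross e3
    clear hS hno
    have : y = y' ∧ z = z' := by grind [Fin.sbtw_iff]
    rw [this.1, this.2]
  · exact absurd hu (not_cwMem_of_apex hW (hc.mem hW) hS hno hx hxa hxb hv h4)

end

/-! ### Counting the diagonals along a path: the lower bound -/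

/-- All the diagonals that appear along a path in the flip graph. -/
def walkDiagonals : {T T' : Triangulation n} → (flipGraph n).Walk T T' →
    Finset (Sym2 (Fin (n + 2)))
  | T, _, .nil => T.diagonals
  | T, _, .cons _ p => T.diagonals ∪ walkDiagonals p

theorem subset_walkDiagonals {T T' : Triangulation n} (p : (flipGraph n).Walk T T') :
    T.diagonals ⊆ walkDiagonals p := by
  cases p with
  | nil => exact subset_rfl
  | cons h p => exact Finset.subset_union_left

theorem subset_walkDiagonals' {T T' : Triangulation n} (p : (flipGraph n).Walk T T') :
    T'.diagonals ⊆ walkDiagonals p := by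
  induction p with
  | nil => exact subset_rfl
  | cons h p ih => exact ih.trans Finset.subset_union_right

theorem card_walkDiagonals_le {T T' : Triangulation n} (p : (flipGraph n).Walk T T') :
    (walkDiagonals p).card ≤ T.diagonals.card + p.length := by
  induction p with
  | nil => exact le_rfl
  | @cons T S T' h p ih =>
    obtain ⟨d, e, hf⟩ := id h
    have hsub : walkDiagonals (.cons h p) ⊆ insert d (walkDiagonals p) := by
      refine Finset.union_subset (fun f hfT => ?_) (Finset.subset_insert _ _)
      by_cases hfd : f = d
      · exact Finset.mem_insert.2 (.inl hfd)
      · refine Finset.mem_insert_of_mem (subset_walkDiagonals p ?_)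
        rw [hf.diagonals_eq]
        exact Finset.mem_insert_of_mem (Finset.mem_erase.2 ⟨hfd, hfT⟩)
    have := (Finset.card_le_card hsub).trans (Finset.card_insert_le _ _)
    rw [hf.card_eq] at ih
    rw [SimpleGraph.Walk.length_cons]
    omega

/-- This isolates the first flip at which the property `P` is lost. -/
theorem exists_flipsTo_of_walk {P : Triangulation n → Prop} {T T' : Triangulation n}
    (p : (flipGraph n).Walk T T') (hT : P T) (hT' : ¬ P T') :
    ∃ S S' d e, FlipsTo S d e S' ∧ P S ∧ ¬ P S' ∧ e ∈ walkDiagonals p := by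
  induction p with
  | nil => exact absurd hT hT'
  | @cons T S T' h p ih =>
    by_cases hS : P S
    · obtain ⟨S₁, S₂, d, e, h1, h2, h3, h4⟩ := ih hS hT'
      exact ⟨S₁, S₂, d, e, h1, h2, h3, Finset.mem_union_right _ h4⟩
    · obtain ⟨d, e, hf⟩ := h
      refine ⟨T, S, d, e, hf, hT, hS, Finset.mem_union_right _ (subset_walkDiagonals p ?_)⟩
      rw [hf.diagonals_eq]
      exact Finset.mem_insert_self _ _

section
variable {T : Triangulation n} {t : Finset (Fin (n + 2))} {e : Sym2 (Fin (n + 2))}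

theorem Cuts.notMem (ht : t ∈ T.internalTriangles) (h : Cuts t e) : e ∉ T.diagonals := by
  obtain ⟨p, y, z, u, h1, rfl, h2, rfl⟩ := h
  intro he
  have h3 := ((Triangulation.mem_internalTriangles h1).1 ht).2.1
  exact (Triangulation.hasEdge_of_mem h3).not_cross (Triangulation.hasEdge_of_mem he).symm h2
    (sbtw_cyclic_left (sbtw_cyclic_left h1))

/-- A segment from `p` beyond `s(y, z)` crosses `s(p - 1, y - 1)`, the rotation of a side at `p`. -/
theorem Cuts.notMem_rotate (ht : t ∈ T.internalTriangles) (h : Cuts t e) :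
    e ∉ T.rotate.diagonals := by
  obtain ⟨p, y, z, u, h1, rfl, h2, rfl⟩ := h
  intro he
  obtain ⟨h3, -, h4⟩ := (Triangulation.mem_internalTriangles h1).1 ht
  have h5 := Triangulation.hasEdge_of_mem (Triangulation.mem_rotate.2 h3)
  have a1 := val_sub_one p
  have a2 := val_sub_one y
  have a3 := Triangulation.ne_add_one_of_mem h3
  have a4 := Triangulation.ne_add_one_of_mem h4
  have a5 : p - 1 ≠ z := fun h => a4.1 (by rw [← h]; simp)
  have a6 : p ≠ y - 1 := fun h => a3.1 (by rw [h]; simp)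
  refine h5.not_cross (Triangulation.hasEdge_of_mem he) ?_ ?_
  all_goals
    clear h5 he h3 h4 ht a3 a4
    have := p.isLt
    have := y.isLt
    have := z.isLt
    have := u.isLt
    generalize p - 1 = p' at *
    generalize y - 1 = y' at *
    simp only [Fin.sbtw_iff, Fin.lt_def, Fin.ext_iff, ne_eq] at *
    omega

end

/-- All boundary edges of `W` are in `T` and none survives in the rotation, so some flip is the
first to remove one. The diagonal which it produces is the required one. -/
theorem exists_existsUnique_cuts {T : Triangulation n} (p : (flipGraph n).Walk T T.rotate)
    {W : Finset (Finset (Fin (n + 2)))} (hW : W ⊆ T.internalTriangles) (hne : W.Nonempty) :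
    ∃ e ∈ walkDiagonals p, ∃! t, t ∈ W ∧ Cuts t e := by
  obtain ⟨a, b, hab⟩ := exists_isBoundary hW hne
  obtain ⟨S, S', d, e, hf, hS, hS', he⟩ := exists_flipsTo_of_walk
    (P := fun S => ∀ a b, IsBoundary W a b → s(a, b) ∈ S.diagonals) p
    (fun a b h => h.1.choose_spec.mem hW)
    (fun h => Triangulation.notMem_rotate (hab.1.choose_spec.mem hW) (h a b hab))
  refine ⟨e, he, ?_⟩
  push Not at hS'
  obtain ⟨a, b, hab, hnot⟩ := hS'
  have hd : d = s(a, b) := by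
    by_contra hne
    refine hnot ?_
    rw [hf.diagonals_eq]
    exact Finset.mem_insert_of_mem (Finset.mem_erase.2 ⟨fun h => hne h.symm, hS a b hab⟩)
  obtain ⟨i, j, k, l, h1, h2, e1, e2, e3, e4, hd', rfl, -, -⟩ := hf
  rw [hd, Sym2.eq_iff] at hd'
  rcases hd' with ⟨rfl, rfl⟩ | ⟨rfl, rfl⟩
  · rw [Sym2.eq_swap]
    exact existsUnique_cuts_of_quadrilateral hW hS hab h1 h2 e1.symm e2 e4 e3.symm
  · exact existsUnique_cuts_of_quadrilateral hW hS hab h2 h1 e3.symm e4 e2 e1.symm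

/-- Hall-type induction: the diagonal that cuts only `t` among the triangles of `W` is no longer
counted for `W.erase t`, so each removal of a triangle loses at least one diagonal. -/
theorem card_le_card_filter_cuts {T : Triangulation n} (p : (flipGraph n).Walk T T.rotate)
    [∀ W : Finset (Finset (Fin (n + 2))), DecidablePred fun e => ∃ t ∈ W, Cuts t e]
    (W : Finset (Finset (Fin (n + 2)))) (hW : W ⊆ T.internalTriangles) :
    W.card ≤ ((walkDiagonals p).filter fun e => ∃ t ∈ W, Cuts t e).card := by
  induction hm : W.card generalizing W with
  | zero => exact Nat.zero_le _
  | succ m ih =>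
    obtain ⟨e, he, t, ⟨ht, hte⟩, huniq⟩ := exists_existsUnique_cuts p hW
      (Finset.card_pos.1 (by omega))
    have := ih (W.erase t) ((Finset.erase_subset _ _).trans hW)
      (by rw [Finset.card_erase_of_mem ht]; omega)
    refine lt_of_le_of_lt this (Finset.card_lt_card (Finset.ssubset_iff_subset_ne.2 ⟨?_, ?_⟩))
    · intro f hf
      obtain ⟨h1, t', h2, h3⟩ := Finset.mem_filter.1 hf
      exact Finset.mem_filter.2 ⟨h1, t', Finset.mem_of_mem_erase h2, h3⟩
    · intro heq
      have : e ∈ (walkDiagonals p).filter fun e => ∃ t ∈ W, Cuts t e :=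
        Finset.mem_filter.2 ⟨he, t, ht, hte⟩
      rw [← heq] at this
      obtain ⟨-, t', h2, h3⟩ := Finset.mem_filter.1 this
      exact (Finset.mem_erase.1 h2).1 (huniq t' ⟨Finset.mem_of_mem_erase h2, h3⟩)

/-- A path in the flip graph from `T` to its rotation has length at least
`n - 1 + T.internalTriangles.card`. -/
theorem le_length_of_walk {T : Triangulation n} (p : (flipGraph n).Walk T T.rotate) :
    n - 1 + T.internalTriangles.card ≤ p.length := by
  classical
  have h1 := card_walkDiagonals_le p
  have h2 := card_le_card_filter_cuts p T.internalTriangles subset_rfl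
  set X := (walkDiagonals p).filter fun e => ∃ t ∈ T.internalTriangles, Cuts t e with hX
  have h3 : (T.diagonals ∪ T.rotate.diagonals) ∪ X ⊆ walkDiagonals p :=
    Finset.union_subset (Finset.union_subset (subset_walkDiagonals p) (subset_walkDiagonals' p))
      (Finset.filter_subset _ _)
  have h4 := Finset.card_le_card h3
  rw [Finset.card_union_of_disjoint, Finset.card_union_of_disjoint,
    T.rotate.card_diagonals, T.card_diagonals] at h4
  · rw [T.card_diagonals] at h1
    omega
  · exact Finset.disjoint_left.2 fun d h => Triangulation.notMem_rotate h
  · refine Finset.disjoint_left.2 fun d h h' => ?_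
    obtain ⟨-, t, ht, hc⟩ := Finset.mem_filter.1 h'
    rcases Finset.mem_union.1 h with h | h
    · exact hc.notMem ht h
    · exact hc.notMem_rotate ht h

end PolygonFlip

namespace PolygonFlip

variable {n : ℕ}

/-! ### Where unblocked diagonals and initial diagonals are flipped to -/

theorem sbtw_add_one {x y : Fin (n + 2)} (h : y ≠ x) (h' : y ≠ x + 1) : sbtw x (x + 1) y := by
  have := sbtw_sub_one_left (x := x + 1) (y := y) h' (by rwa [add_sub_cancel_right])
  rwa [add_sub_cancel_right] at this

theorem sbtw_sub_one_right {x y : Fin (n + 2)} (h : y ≠ x) (h' : y ≠ x - 1) :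
    sbtw y (x - 1) x := by
  have := sbtw_sub_one_left h h'
  grind [Fin.sbtw_iff]

theorem isSide_sub_one (x : Fin (n + 2)) : IsSide (x - 1) x := .inl (by simp)

namespace Triangulation

variable {S : Triangulation n}

theorem ne_sub_one_of_mem {i j : Fin (n + 2)} (h : s(i, j) ∈ S.diagonals) :
    i ≠ j - 1 ∧ j ≠ i - 1 := by
  have := ne_add_one_of_mem h
  exact ⟨fun h => this.1 (by rw [h]; simp), fun h => this.2 (by rw [h]; simp)⟩

/-- If no diagonal at `i` is counterclockwise to `s(i, j)`, then the triangle on that side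
is `j, i - 1, i`. -/
theorem hasEdge_sub_one {i j : Fin (n + 2)} (h : s(i, j) ∈ S.diagonals)
    (hi : ∀ x, s(i, x) ∈ S.diagonals → ¬ sbtw j x i) : S.HasEdge j (i - 1) := by
  have h' : s(j, i) ∈ S.diagonals := by rwa [Sym2.eq_swap]
  obtain ⟨k, hk⟩ := exists_sbtw_of_mem h'
  obtain ⟨x, hx, h1, h2⟩ := exists_apex (hasEdge_of_mem h') hk
  rcases h2 with h2 | h2
  · rcases h2 with rfl | rfl
    · rwa [add_sub_cancel_right]
    · have := sbtw_add_one (x := i) (y := j) (mem_ne h').symm.symm (ne_add_one_of_mem h).1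
      exact absurd this (by grind [Fin.sbtw_iff])
  · exact absurd hx (hi x (by rwa [Sym2.eq_swap]))

theorem sbtw_sub_one_of_mem {i j : Fin (n + 2)} (h : s(i, j) ∈ S.diagonals) :
    sbtw j (i - 1) i :=
  sbtw_sub_one_right (mem_ne h).symm (ne_sub_one_of_mem h).2

end Triangulation

/-- A diagonal without counterclockwise incident diagonals is rotated by its flip. -/
theorem FlipsTo.eq_rotate {S S' : Triangulation n} {i j : Fin (n + 2)} {e : Sym2 (Fin (n + 2))}
    (h : FlipsTo S s(i, j) e S') (hi : ∀ x, s(i, x) ∈ S.diagonals → ¬ sbtw j x i)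
    (hj : ∀ x, s(j, x) ∈ S.diagonals → ¬ sbtw i x j) : e = s(i - 1, j - 1) := by
  have hij := h.mem
  have hji : s(j, i) ∈ S.diagonals := by rw [Sym2.eq_swap]; exact hij
  rw [Sym2.eq_swap (a := i - 1)]
  exact h.eq_of_quadrilateral (Triangulation.sbtw_sub_one_of_mem hji)
    (Triangulation.sbtw_sub_one_of_mem hij) (Triangulation.hasEdge_sub_one hji hj)
    (.inl (isSide_sub_one _)) (Triangulation.hasEdge_sub_one hij hi) (.inl (isSide_sub_one _))

/-- The flip of a side `s(a, b)` of a triangle `a b c` without counterclockwise diagonals at `b`. -/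
theorem FlipsTo.eq_start {S S' : Triangulation n} {a b c : Fin (n + 2)} {e : Sym2 (Fin (n + 2))}
    (h : FlipsTo S s(a, b) e S') (habc : sbtw a b c) (hbc : s(b, c) ∈ S.diagonals)
    (hca : s(c, a) ∈ S.diagonals) (hb : ∀ x, s(b, x) ∈ S.diagonals → ¬ sbtw a x b) :
    e = s(b - 1, c) := by
  have hba : s(b, a) ∈ S.diagonals := by rw [Sym2.eq_swap]; exact h.mem
  exact h.eq_of_quadrilateral (Triangulation.sbtw_sub_one_of_mem hba) (sbtw_cyclic_left habc)
    (Triangulation.hasEdge_sub_one hba hb) (.inl (isSide_sub_one _))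
    (Triangulation.hasEdge_of_mem hbc) (Triangulation.hasEdge_of_mem hca)

/-! ### The invariant of the procedure and its direct consequences -/

/-- The stack of the triangles under rotation, the current one first. -/
def State.stack (s : State n) : List (StartedTriangle n) := s.current.toList ++ s.pending

/-- The set of vertices of a triangle. -/
def StartedTriangle.verts (t : StartedTriangle n) : Finset (Fin (n + 2)) := {t.a, t.b, t.c}

/-- The triangle `t` lies beyond the side `s(t'.b, t'.c)` of `t'`. -/
def StartedTriangle.Beyond (t t' : StartedTriangle n) : Prop :=
  ¬ sbtw t'.c t.a t'.b ∧ ¬ sbtw t'.c t.b t'.b ∧ ¬ sbtw t'.c t.c t'.b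

/-- The invariant of the procedure; `D` is the set of the internal triangles started so far. -/
structure Inv (T : Triangulation n) (s : State n) (D : Finset (Finset (Fin (n + 2)))) : Prop where
  unflipped_subset : s.unflipped ⊆ T.diagonals
  unflipped_subset_tri : s.unflipped ⊆ s.tri.diagonals
  cover : ∀ d ∈ s.tri.diagonals, d ∈ s.unflipped ∨ d ∈ T.rotate.diagonals ∨
    ∃ t ∈ s.stack, d = t.moved
  started_subset : D ⊆ T.internalTriangles
  cw : ∀ t ∈ s.stack, sbtw t.a t.b t.c
  verts_mem : ∀ t ∈ s.stack, t.verts ∈ D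
  moved_eq : ∀ t ∈ s.stack, t.moved = s(t.b - 1, t.c)
  moved_mem : ∀ t ∈ s.stack, t.moved ∈ s.tri.diagonals
  initial_notMem : ∀ t ∈ s.stack, s(t.a, t.b) ∉ s.unflipped
  most : ∀ t ∈ s.stack, ∀ x, s(t.b, x) ∈ s.unflipped → ¬ sbtw t.a x t.b
  nested : s.stack.Pairwise StartedTriangle.Beyond
  -- The exceptions reflect the detour: the rotation of the initial side appears only with the flip
  -- of the third side, and the rotation of the third side only with the second flip of the initial
  -- diagonal.
  flipped : ∀ d ∈ T.diagonals, d ∉ s.unflipped → d.map (· - 1) ∈ s.tri.diagonals ∨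
    ∃ t ∈ s.stack, (d = s(t.a, t.b) ∧ s(t.c, t.a) ∈ s.unflipped) ∨
      (d = s(t.c, t.a) ∧ s(t.c, t.a) ∉ s.unflipped)
  unstarted : ∀ t ∈ T.internalTriangles, t ∉ D → ∀ i ∈ t, ∀ j ∈ t, i ≠ j → s(i, j) ∈ s.unflipped
  finished : ∀ t ∈ D, (∃ r ∈ s.stack, t = r.verts) ∨
    ∀ i ∈ t, ∀ j ∈ t, i ≠ j → s(i, j) ∉ s.unflipped
  pending_eq : s.current = none → s.pending = []

namespace Inv

variable {T : Triangulation n} {s : State n} {D : Finset (Finset (Fin (n + 2)))}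

theorem initial (T : Triangulation n) : Inv T (State.init T) ∅ where
  unflipped_subset := subset_rfl
  unflipped_subset_tri := subset_rfl
  cover := fun _ hd => .inl hd
  started_subset := Finset.empty_subset _
  cw := by simp [State.init, State.stack]
  verts_mem := by simp [State.init, State.stack]
  moved_eq := by simp [State.init, State.stack]
  moved_mem := by simp [State.init, State.stack]
  initial_notMem := by simp [State.init, State.stack]
  most := by simp [State.init, State.stack]
  nested := by simp [State.init, State.stack]
  flipped := fun d hd hd' => absurd hd hd'
  unstarted := by
    intro t ht _ i hi j hj hij
    exact (Finset.mem_filter.1 ht).2 i hi j hj hij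
  finished := by simp
  pending_eq := fun _ => rfl

theorem mem_diagonals (h : Inv T s D) {t : StartedTriangle n} (ht : t ∈ s.stack) :
    s(t.a, t.b) ∈ T.diagonals ∧ s(t.b, t.c) ∈ T.diagonals ∧ s(t.c, t.a) ∈ T.diagonals :=
  (Triangulation.mem_internalTriangles (h.cw t ht)).1 (h.started_subset (h.verts_mem t ht))

theorem beyond_or (h : Inv T s D) {t t' : StartedTriangle n} (ht : t ∈ s.stack)
    (ht' : t' ∈ s.stack) (hne : t ≠ t') : t.Beyond t' ∨ t'.Beyond t := by
  have hp : s.stack.Pairwise fun t t' => t.Beyond t' ∨ t'.Beyond t :=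
    h.nested.imp fun h => .inl h
  have : Std.Symm fun t t' : StartedTriangle n => t.Beyond t' ∨ t'.Beyond t :=
    ⟨fun _ _ h => Or.symm h⟩
  exact hp.forall ht ht' hne

/-- The temporary diagonal leaves `t.c` through `s(t.a, t.b)`; hence it is in neither `T` nor
`T.rotate`, like the extra diagonals of the lower bound. -/
theorem cuts_moved (h : Inv T s D) {t : StartedTriangle n} (ht : t ∈ s.stack) :
    Cuts t.verts t.moved := by
  obtain ⟨h1, h2, h3⟩ := h.mem_diagonals ht
  refine ⟨t.c, t.a, t.b, t.b - 1, ?_, ?_, ?_, ?_⟩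
  · exact sbtw_cyclic_left (sbtw_cyclic_left (h.cw t ht))
  · unfold StartedTriangle.verts
    rw [triple_rotate, triple_rotate]
  · rw [Sym2.eq_swap] at h1
    exact Triangulation.sbtw_sub_one_of_mem h1
  · rw [h.moved_eq t ht, Sym2.eq_swap]

theorem moved_notMem (h : Inv T s D) {t : StartedTriangle n} (ht : t ∈ s.stack) :
    t.moved ∉ T.diagonals :=
  (h.cuts_moved ht).notMem (h.started_subset (h.verts_mem t ht))

theorem moved_notMem_rotate (h : Inv T s D) {t : StartedTriangle n} (ht : t ∈ s.stack) :
    t.moved ∉ T.rotate.diagonals :=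
  (h.cuts_moved ht).notMem_rotate (h.started_subset (h.verts_mem t ht))

/-- What can be counterclockwise to a diagonal of the original triangulation. -/
theorem blocker (h : Inv T s D) {p q u : Fin (n + 2)} (hpq : s(p, q) ∈ T.diagonals)
    (hu : s(p, u) ∈ s.tri.diagonals) (hquq : sbtw q u p) :
    s(p, u) ∈ s.unflipped ∨ ∃ t ∈ s.stack, t.c = p ∧ u = t.b - 1 := by
  have hne := Triangulation.mem_ne hpq
  have hs := Triangulation.ne_add_one_of_mem hpq
  have h1 := sbtw_add_one (x := p) (y := q) hne.symm hs.1
  rcases h.cover _ hu with h2 | h2 | ⟨t, ht, h2⟩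
  · exact .inl h2
  -- A rotated diagonal `s(p, u)` comes from `s(p + 1, u + 1)` in `T`, which would cross `s(p, q)`.
  · exfalso
    rw [Triangulation.mem_rotate'] at h2
    have h3 := Triangulation.ne_add_one_of_mem h2
    refine (Triangulation.hasEdge_of_mem hpq).not_cross (Triangulation.hasEdge_of_mem h2) h1 ?_
    have h4 : u + 1 ≠ p := fun h => h3.2 (by rw [h])
    have h5 : p ≠ u := Triangulation.mem_ne hu
    have h6 := sbtw_add_one (x := u) (y := p) h5 h4.symm
    grind [Fin.sbtw_iff]
  · rw [h.moved_eq t ht, Sym2.eq_iff] at h2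
    rcases h2 with ⟨h2, h3⟩ | ⟨h2, h3⟩
    · exfalso
      have h4 : p + 1 = t.b := by rw [h2]; simp
      have h5 := (h.mem_diagonals ht).2.1
      refine (Triangulation.hasEdge_of_mem hpq).not_cross (Triangulation.hasEdge_of_mem h5)
        (h4 ▸ h1) (h3 ▸ hquq)
    · exact .inr ⟨t, ht, h2.symm, h3⟩

/-- The third side of a triangle under rotation is blocked. -/
theorem ccwAt_moved (h : Inv T s D) {t : StartedTriangle n} (ht : t ∈ s.stack) :
    s(t.c, t.b - 1) ∈ s.tri.diagonals ∧ sbtw t.a (t.b - 1) t.c := by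
  have h1 := h.moved_mem t ht
  rw [h.moved_eq t ht, Sym2.eq_swap] at h1
  refine ⟨h1, ?_⟩
  have h2 := (h.mem_diagonals ht).1
  rw [Sym2.eq_swap] at h2
  have h3 := Triangulation.sbtw_sub_one_of_mem h2
  have := h.cw t ht
  grind [Fin.sbtw_iff]

/-- The second side of a triangle under rotation is not blocked at its first vertex. -/
theorem second_unblocked (h : Inv T s D) {t : StartedTriangle n} (ht : t ∈ s.stack)
    (x : Fin (n + 2)) (hx : s(t.b, x) ∈ s.tri.diagonals) : ¬ sbtw t.c x t.b := by
  intro hcx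
  obtain ⟨h1, h2, h3⟩ := h.mem_diagonals ht
  have hcw := h.cw t ht
  rcases h.blocker h2 hx hcx with h4 | ⟨r, hr, h5, h6⟩
  · have h5 := h.most t ht x h4
    have h6 : x ≠ t.a := by
      rintro rfl
      rw [Sym2.eq_swap] at h4
      exact h.initial_notMem t ht h4
    have h7 := (Triangulation.hasEdge_of_mem h3).not_cross
      (Triangulation.hasEdge_of_mem (h.unflipped_subset h4)).symm
    grind [Fin.sbtw_iff]
  · have hne : t ≠ r := by
      rintro rfl
      exact Triangulation.mem_ne h2 h5.symm
    have h7 := (h.mem_diagonals hr).2.1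
    have h8 := Triangulation.mem_ne h7
    have hbc := Triangulation.mem_ne h2
    have h9 : sbtw t.c r.b t.b := by
      rw [h5] at h8
      rw [h6] at hcx
      have h10 := sbtw_sub_one_left (x := r.b) (y := t.b) h8.symm
        (fun h => by rw [← h] at hcx; exact sbtw_irrefl_right hcx)
      grind [Fin.sbtw_iff]
    rcases h.beyond_or ht hr hne with hb | hb
    · have := hb.2.2
      rw [h5] at this
      grind [Fin.sbtw_iff]
    · exact hb.2.1 h9

/-- A side of an internal triangle not yet started is blocked by another one. -/
theorem blocked_of_unstarted (h : Inv T s D) {t : Finset (Fin (n + 2))}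
    (ht : t ∈ T.internalTriangles) (htD : t ∉ D) {i j : Fin (n + 2)} (hi : i ∈ t) (hj : j ∈ t)
    (hij : i ≠ j) : ∃ k, t = {i, j, k} ∧ ((sbtw i j k ∧ s(i, k) ∈ s.unflipped ∧ sbtw j k i) ∨
      (sbtw j i k ∧ s(j, k) ∈ s.unflipped ∧ sbtw i k j)) := by
  obtain ⟨a, b, c, habc, rfl⟩ := Triangulation.exists_of_mem_internalTriangles ht
  have key := h.unstarted _ ht htD
  have h1 : sbtw b c a := sbtw_cyclic_left habc
  have h2 : sbtw c a b := sbtw_cyclic_left h1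
  simp only [Finset.mem_insert, Finset.mem_singleton] at hi hj
  have n1 : a ≠ b := by rintro rfl; exact sbtw_irrefl_left habc
  have n2 : b ≠ c := by rintro rfl; exact sbtw_irrefl_right habc
  have n3 : c ≠ a := by rintro rfl; exact sbtw_irrefl_left_right habc
  have k1 := key a (by simp) b (by simp) n1
  have k2 := key b (by simp) c (by simp) n2
  have k3 := key c (by simp) a (by simp) n3
  have k1' : s(b, a) ∈ s.unflipped := by rwa [Sym2.eq_swap]
  have k2' : s(c, b) ∈ s.unflipped := by rwa [Sym2.eq_swap]
  have k3' : s(a, c) ∈ s.unflipped := by rwa [Sym2.eq_swap]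
  rcases hi with rfl | rfl | rfl <;> rcases hj with rfl | rfl | rfl
  · exact absurd rfl hij
  · exact ⟨c, rfl, .inl ⟨habc, k3', h1⟩⟩
  · exact ⟨b, by ext; simp; tauto, .inr ⟨h2, k2', habc⟩⟩
  · exact ⟨c, by ext; simp; tauto, .inr ⟨habc, k3', h1⟩⟩
  · exact absurd rfl hij
  · exact ⟨a, by ext; simp; tauto, .inl ⟨h1, k1', h2⟩⟩
  · exact ⟨b, by ext; simp; tauto, .inl ⟨h2, k2', habc⟩⟩
  · exact ⟨a, by ext; simp; tauto, .inr ⟨h1, k1', h2⟩⟩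
  · exact absurd rfl hij

end Inv
end PolygonFlip

namespace PolygonFlip

variable {n : ℕ}

/-! ### Preservation of the invariant by the different types of flips -/

theorem FlipsTo.mem_of_ne {S S' : Triangulation n} {d e f : Sym2 (Fin (n + 2))}
    (h : FlipsTo S d e S') (hf : f ∈ S.diagonals) (hne : f ≠ d) : f ∈ S'.diagonals := by
  rw [h.diagonals_eq]
  exact Finset.mem_insert_of_mem (Finset.mem_erase.2 ⟨hne, hf⟩)

theorem FlipsTo.mem_new {S S' : Triangulation n} {d e : Sym2 (Fin (n + 2))}
    (h : FlipsTo S d e S') : e ∈ S'.diagonals := by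
  rw [h.diagonals_eq]
  exact Finset.mem_insert_self _ _

theorem FlipsTo.eq_or_mem {S S' : Triangulation n} {d e f : Sym2 (Fin (n + 2))}
    (h : FlipsTo S d e S') (hf : f ∈ S'.diagonals) : f = e ∨ f ∈ S.diagonals ∧ f ≠ d := by
  rw [h.diagonals_eq, Finset.mem_insert, Finset.mem_erase] at hf
  tauto

namespace Inv

variable {T T' : Triangulation n} {s : State n} {D : Finset (Finset (Fin (n + 2)))}

theorem map_sub_one_mem_rotate {d : Sym2 (Fin (n + 2))} (h : d ∈ T.diagonals) :
    d.map (· - 1) ∈ T.rotate.diagonals :=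
  Finset.mem_image_of_mem _ h

theorem map_sub_one_ne {d f : Sym2 (Fin (n + 2))} (hd : d ∈ T.diagonals)
    (hf : f ∈ T.diagonals) : f.map (· - 1) ≠ d := by
  rintro rfl
  exact Triangulation.notMem_rotate hd (map_sub_one_mem_rotate hf)

/-- Preservation of the invariant if an unflipped diagonal is exchanged for a diagonal of the
rotated triangulation. -/
theorem flip_of_mem_rotate (h : Inv T s D) {d e : Sym2 (Fin (n + 2))} (hd : d ∈ s.unflipped)
    (hf : FlipsTo s.tri d e T') (he : e ∈ T.rotate.diagonals)
    (hunst : ∀ t ∈ T.internalTriangles, t ∉ D → ∀ i ∈ t, ∀ j ∈ t, i ≠ j → s(i, j) ≠ d)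
    (hflipped : ∀ f ∈ T.diagonals, f ∉ s.unflipped.erase d → f.map (· - 1) ∈ T'.diagonals ∨
      ∃ t ∈ s.stack, (f = s(t.a, t.b) ∧ s(t.c, t.a) ∈ s.unflipped.erase d) ∨
        (f = s(t.c, t.a) ∧ s(t.c, t.a) ∉ s.unflipped.erase d)) :
    Inv T ⟨T', s.unflipped.erase d, s.current, s.pending⟩ D where
  unflipped_subset := (Finset.erase_subset _ _).trans h.unflipped_subset
  unflipped_subset_tri := fun f hfm =>
    hf.mem_of_ne (h.unflipped_subset_tri (Finset.mem_of_mem_erase hfm)) (Finset.ne_of_mem_erase hfm)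
  cover := by
    intro f hfm
    rcases hf.eq_or_mem hfm with rfl | ⟨h1, h2⟩
    · exact .inr (.inl he)
    · rcases h.cover f h1 with h3 | h3
      · exact .inl (Finset.mem_erase.2 ⟨h2, h3⟩)
      · exact .inr h3
  started_subset := h.started_subset
  cw := h.cw
  verts_mem := h.verts_mem
  moved_eq := h.moved_eq
  moved_mem := fun t ht => hf.mem_of_ne (h.moved_mem t ht)
    (fun heq => h.moved_notMem ht (heq ▸ h.unflipped_subset hd))
  initial_notMem := fun t ht hm => h.initial_notMem t ht (Finset.mem_of_mem_erase hm)
  most := fun t ht x hx => h.most t ht x (Finset.mem_of_mem_erase hx)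
  nested := h.nested
  flipped := hflipped
  unstarted := fun t ht htD i hi j hj hij => Finset.mem_erase.2
    ⟨hunst t ht htD i hi j hj hij, h.unstarted t ht htD i hi j hj hij⟩
  finished := fun t ht => (h.finished t ht).imp id fun h i hi j hj hij hm =>
    h i hi j hj hij (Finset.mem_of_mem_erase hm)
  pending_eq := h.pending_eq

theorem flip_rotate (h : Inv T s D) {d : Sym2 (Fin (n + 2))} (hd : d ∈ s.unflipped)
    (hf : FlipsTo s.tri d (d.map (· - 1)) T')
    (hunst : ∀ t ∈ T.internalTriangles, t ∉ D → ∀ i ∈ t, ∀ j ∈ t, i ≠ j → s(i, j) ≠ d)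
    (hthird : ∀ t ∈ s.stack, s(t.c, t.a) ≠ d) :
    Inv T ⟨T', s.unflipped.erase d, s.current, s.pending⟩ D := by
  refine h.flip_of_mem_rotate hd hf (map_sub_one_mem_rotate (h.unflipped_subset hd)) hunst ?_
  intro f hfT hfm
  by_cases hfd : f = d
  · subst hfd
    exact .inl hf.mem_new
  · rcases h.flipped f hfT (fun hm => hfm (Finset.mem_erase.2 ⟨hfd, hm⟩)) with
      h1 | ⟨t, ht, ⟨h1, h2⟩ | ⟨h1, h2⟩⟩
    · exact .inl (hf.mem_of_ne h1 (map_sub_one_ne (h.unflipped_subset hd) hfT))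
    · exact .inr ⟨t, ht, .inl ⟨h1, Finset.mem_erase.2 ⟨hthird t ht, h2⟩⟩⟩
    · exact .inr ⟨t, ht, .inr ⟨h1, fun hm => h2 (Finset.mem_of_mem_erase hm)⟩⟩

/-- The third side takes the place intended for the initial side: one exception in `Inv.flipped` is
resolved and replaced by the other one. -/
theorem flip_third (h : Inv T s D) {t : StartedTriangle n} (ht : t ∈ s.stack)
    (hd : s(t.c, t.a) ∈ s.unflipped)
    (hf : FlipsTo s.tri s(t.c, t.a) (s(t.a, t.b).map (· - 1)) T')
    (hunst : ∀ r ∈ T.internalTriangles, r ∉ D → ∀ i ∈ r, ∀ j ∈ r, i ≠ j → s(i, j) ≠ s(t.c, t.a))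
    (hthird : ∀ r ∈ s.stack, r ≠ t → s(r.c, r.a) ≠ s(t.c, t.a)) :
    Inv T ⟨T', s.unflipped.erase s(t.c, t.a), s.current, s.pending⟩ D := by
  refine h.flip_of_mem_rotate hd hf (map_sub_one_mem_rotate (h.mem_diagonals ht).1) hunst ?_
  intro f hfT hfm
  by_cases hfd : f = s(t.c, t.a)
  · exact .inr ⟨t, ht, .inr ⟨hfd, Finset.notMem_erase _ _⟩⟩
  · rcases h.flipped f hfT (fun hm => hfm (Finset.mem_erase.2 ⟨hfd, hm⟩)) with
      h1 | ⟨r, hr, ⟨h1, h2⟩ | ⟨h1, h2⟩⟩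
    · exact .inl (hf.mem_of_ne h1 (map_sub_one_ne (h.unflipped_subset hd) hfT))
    · by_cases hrt : r = t
      · subst hrt
        rw [h1]
        exact .inl hf.mem_new
      · exact .inr ⟨r, hr, .inl ⟨h1, Finset.mem_erase.2 ⟨hthird r hr hrt, h2⟩⟩⟩
    · exact .inr ⟨r, hr, .inr ⟨h1, fun hm => h2 (Finset.mem_of_mem_erase hm)⟩⟩

/-- Preservation of the invariant when the rotation of an internal triangle is begun. -/
theorem flip_initial (h : Inv T s D) {s' : State n} {a b c : Fin (n + 2)}
    {e : Sym2 (Fin (n + 2))} (habc : sbtw a b c) (hint : {a, b, c} ∈ T.internalTriangles)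
    (hD : {a, b, c} ∉ D) (hb : ∀ x, s(b, x) ∈ s.tri.diagonals → ¬ sbtw a x b)
    (hthird : ∀ t ∈ s.stack, s(t.c, t.a) ≠ s(a, b))
    (hf : FlipsTo s.tri s(a, b) e s'.tri) (hunf : s'.unflipped = s.unflipped.erase s(a, b))
    (hmem : ∀ r, r ∈ s'.stack ↔ r = ⟨a, b, c, e⟩ ∨ r ∈ s.stack)
    (hnested : s'.stack.Pairwise StartedTriangle.Beyond)
    (hpend : s'.current = none → s'.pending = []) :
    Inv T s' (insert {a, b, c} D) := by
  have n1 : a ≠ b := by rintro rfl; exact sbtw_irrefl_left habc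
  have n2 : b ≠ c := by rintro rfl; exact sbtw_irrefl_right habc
  have n3 : c ≠ a := by rintro rfl; exact sbtw_irrefl_left_right habc
  have key := h.unstarted _ hint hD
  have k1 := key a (by simp) b (by simp) n1
  have k2 := key b (by simp) c (by simp) n2
  have k3 := key c (by simp) a (by simp) n3
  have he : e = s(b - 1, c) :=
    hf.eq_start habc (h.unflipped_subset_tri k2) (h.unflipped_subset_tri k3) hb
  have hold : ∀ r ∈ s.stack, r ∈ s'.stack := fun r hr => (hmem r).2 (.inr hr)
  constructor
  case unflipped_subset =>
    rw [hunf]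
    exact (Finset.erase_subset _ _).trans h.unflipped_subset
  case unflipped_subset_tri =>
    intro f hfm
    rw [hunf] at hfm
    exact hf.mem_of_ne (h.unflipped_subset_tri (Finset.mem_of_mem_erase hfm))
      (Finset.ne_of_mem_erase hfm)
  case cover =>
    intro f hfm
    rcases hf.eq_or_mem hfm with rfl | ⟨h1, h2⟩
    · exact .inr (.inr ⟨_, (hmem _).2 (.inl rfl), rfl⟩)
    · rcases h.cover f h1 with h3 | h3 | ⟨r, hr, h3⟩
      · exact .inl (by rw [hunf]; exact Finset.mem_erase.2 ⟨h2, h3⟩)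
      · exact .inr (.inl h3)
      · exact .inr (.inr ⟨r, hold r hr, h3⟩)
  case started_subset =>
    exact Finset.insert_subset hint h.started_subset
  case cw =>
    intro t ht
    rcases (hmem t).1 ht with rfl | ht
    · exact habc
    · exact h.cw t ht
  case verts_mem =>
    intro t ht
    rcases (hmem t).1 ht with rfl | ht
    · exact Finset.mem_insert_self _ _
    · exact Finset.mem_insert_of_mem (h.verts_mem t ht)
  case moved_eq =>
    intro t ht
    rcases (hmem t).1 ht with rfl | ht
    · exact he
    · exact h.moved_eq t ht
  case moved_mem =>
    intro t ht
    rcases (hmem t).1 ht with rfl | ht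
    · exact hf.mem_new
    · exact hf.mem_of_ne (h.moved_mem t ht)
        (fun heq => h.moved_notMem ht (heq ▸ h.unflipped_subset k1))
  case initial_notMem =>
    intro t ht
    rw [hunf]
    rcases (hmem t).1 ht with rfl | ht
    · exact Finset.notMem_erase _ _
    · exact fun hm => h.initial_notMem t ht (Finset.mem_of_mem_erase hm)
  case most =>
    intro t ht x hx
    rw [hunf] at hx
    rcases (hmem t).1 ht with rfl | ht
    · exact hb x (h.unflipped_subset_tri (Finset.mem_of_mem_erase hx))
    · exact h.most t ht x (Finset.mem_of_mem_erase hx)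
  case nested => exact hnested
  case flipped =>
    intro f hfT hfm
    rw [hunf] at hfm ⊢
    by_cases hfd : f = s(a, b)
    · refine .inr ⟨_, (hmem _).2 (.inl rfl), .inl ⟨hfd, Finset.mem_erase.2 ⟨?_, k3⟩⟩⟩
      intro heq
      rw [Sym2.eq_iff] at heq
      tauto
    · rcases h.flipped f hfT (fun hm => hfm (Finset.mem_erase.2 ⟨hfd, hm⟩)) with
        h1 | ⟨r, hr, ⟨h1, h2⟩ | ⟨h1, h2⟩⟩
      · exact .inl (hf.mem_of_ne h1 (map_sub_one_ne (h.unflipped_subset k1) hfT))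
      · exact .inr ⟨r, hold r hr, .inl ⟨h1, Finset.mem_erase.2 ⟨hthird r hr, h2⟩⟩⟩
      · exact .inr ⟨r, hold r hr, .inr ⟨h1, fun hm => h2 (Finset.mem_of_mem_erase hm)⟩⟩
  case unstarted =>
    intro t ht htD i hi j hj hij
    rw [Finset.mem_insert, not_or] at htD
    rw [hunf]
    refine Finset.mem_erase.2 ⟨fun heq => ?_, h.unstarted t ht htD.2 i hi j hj hij⟩
    have hab : a ∈ t ∧ b ∈ t := by
      rw [Sym2.eq_iff] at heq
      rcases heq with ⟨rfl, rfl⟩ | ⟨rfl, rfl⟩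
      · exact ⟨hi, hj⟩
      · exact ⟨hj, hi⟩
    -- Another unstarted triangle with side `s(a, b)` would lie on the opposite side of it and have
    -- a diagonal blocking it at `b`.
    obtain ⟨k, rfl, ⟨h1, h2, h3⟩ | ⟨h1, h2, h3⟩⟩ :=
      h.blocked_of_unstarted ht htD.2 hab.1 hab.2 n1
    · refine htD.1 ?_
      obtain ⟨f1, f2, f3⟩ := (Triangulation.mem_internalTriangles h1).1 ht
      have : k = c := Triangulation.apex_unique (sbtw_cyclic_left h1) (sbtw_cyclic_left habc)
        (Triangulation.hasEdge_of_mem f2) (Triangulation.hasEdge_of_mem f3)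
        (Triangulation.hasEdge_of_mem (h.unflipped_subset k2))
        (Triangulation.hasEdge_of_mem (h.unflipped_subset k3))
      rw [this]
    · exact hb k (h.unflipped_subset_tri h2) h3
  case finished =>
    intro t ht
    rcases Finset.mem_insert.1 ht with rfl | ht
    · exact .inl ⟨_, (hmem _).2 (.inl rfl), rfl⟩
    · rcases h.finished t ht with ⟨r, hr, h1⟩ | h1
      · exact .inl ⟨r, hold r hr, h1⟩
      · refine .inr fun i hi j hj hij hm => h1 i hi j hj hij ?_
        rw [hunf] at hm
        exact Finset.mem_of_mem_erase hm
  case pending_eq => exact hpend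

theorem stack_eq {t : StartedTriangle n} (hcur : s.current = some t) :
    s.stack = t :: s.pending := by
  unfold State.stack
  rw [hcur]
  rfl

theorem current_mem {t : StartedTriangle n} (hcur : s.current = some t) : t ∈ s.stack := by
  rw [stack_eq hcur]
  exact List.mem_cons_self

theorem current_beyond (h : Inv T s D) {t r : StartedTriangle n} (hcur : s.current = some t)
    (hr : r ∈ s.stack) (hne : r ≠ t) : t.Beyond r := by
  have := h.nested
  rw [stack_eq hcur] at this hr
  rcases List.mem_cons.1 hr with hr | hr
  · exact absurd hr hne
  · exact (List.pairwise_cons.1 this).1 r hr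

/-- The first vertex of a pending triangle is not a vertex of the current one. -/
theorem ne_of_current (h : Inv T s D) {t r : StartedTriangle n} (hcur : s.current = some t)
    (hr : r ∈ s.stack) (hne : r ≠ t) : r.a ≠ t.a ∧ r.a ≠ t.b ∧ r.a ≠ t.c := by
  obtain ⟨h1, h2, h3⟩ := h.current_beyond hcur hr hne
  have h4 := h.cw r hr
  have h5 : sbtw r.c r.a r.b := sbtw_cyclic_left (sbtw_cyclic_left h4)
  refine ⟨fun h => h1 (h ▸ h5), fun h => h2 (h ▸ h5), fun h => h3 (h ▸ h5)⟩

theorem moved_ne_of_current (h : Inv T s D) {t r : StartedTriangle n}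
    (hcur : s.current = some t) (hr : r ∈ s.stack) (hne : r ≠ t) : r.moved ≠ t.moved := by
  have ht := current_mem hcur
  rw [h.moved_eq t ht, h.moved_eq r hr, ne_eq, Sym2.eq_iff]
  obtain ⟨h1, h2, h3⟩ := h.current_beyond hcur hr hne
  have h5 := h.cw t ht
  rintro (⟨e1, e2⟩ | ⟨e1, e2⟩)
  · have e1 : r.b = t.b := by simpa using e1
    rw [e1, e2] at h1
    exact h1 (sbtw_cyclic_left (sbtw_cyclic_left h5))
  · have e3 : r.b = t.c + 1 := by rw [← e1]; simp
    have g := sbtw_add_one (x := t.c) (y := r.c)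
      (fun h' => (Triangulation.ne_sub_one_of_mem (h.mem_diagonals ht).2.1).2 (by rw [← h', e2]))
      (fun h' => Triangulation.mem_ne (h.mem_diagonals hr).2.1 (by rw [e3, h']))
    rw [← e3] at g
    exact h3 (sbtw_cyclic_left (sbtw_cyclic_left g))

/-- The exceptions in `Inv.flipped` due to another triangle `r` of the stack concern diagonals at
`r.a`, which by nesting is no vertex of the current triangle; the exception for the current one is
excluded by `hca`. -/
theorem rotate_mem_of_current (h : Inv T s D) {t : StartedTriangle n}
    (hcur : s.current = some t) (hca : s(t.c, t.a) ∉ s.unflipped) {d : Sym2 (Fin (n + 2))}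
    (hd : d ∉ s.unflipped) (hd' : d = s(t.a, t.b) ∨ d = s(t.b, t.c)) :
    d.map (· - 1) ∈ s.tri.diagonals := by
  have ht := current_mem hcur
  obtain ⟨m1, m2, m3⟩ := h.mem_diagonals ht
  have n1 := Triangulation.mem_ne m1
  have n2 := Triangulation.mem_ne m2
  have n3 := Triangulation.mem_ne m3
  have hdT : d ∈ T.diagonals := by rcases hd' with rfl | rfl <;> assumption
  rcases h.flipped d hdT hd with h1 | ⟨r, hr, h1⟩
  · exact h1
  · exfalso
    by_cases hrt : r = t
    · subst hrt
      rcases h1 with ⟨-, h1⟩ | ⟨h1, -⟩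
      · exact hca h1
      · subst h1
        rcases hd' with h2 | h2 <;> rw [Sym2.eq_iff] at h2 <;> tauto
    · obtain ⟨a1, a2, a3⟩ := h.ne_of_current hcur hr hrt
      have : r.a ∈ d := by
        rcases h1 with ⟨rfl, -⟩ | ⟨rfl, -⟩
        · exact Sym2.mem_mk_left _ _
        · exact Sym2.mem_mk_right _ _
      rcases hd' with rfl | rfl <;> rw [Sym2.mem_iff] at this <;> tauto

/-- The second flip of the initial diagonal. -/
theorem finish_eq (h : Inv T s D) {t : StartedTriangle n} {e : Sym2 (Fin (n + 2))}
    (hcur : s.current = some t) (hbc : s(t.b, t.c) ∉ s.unflipped)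
    (hca : s(t.c, t.a) ∉ s.unflipped) (hf : FlipsTo s.tri t.moved e T') :
    e = s(t.c, t.a).map (· - 1) := by
  have ht := current_mem hcur
  have hcw := h.cw t ht
  obtain ⟨m1, m2, m3⟩ := h.mem_diagonals ht
  have r1 := h.rotate_mem_of_current hcur hca (h.initial_notMem t ht) (.inl rfl)
  have r2 := h.rotate_mem_of_current hcur hca hbc (.inr rfl)
  rw [Sym2.map_mk] at r1 r2 ⊢
  rw [h.moved_eq t ht] at hf
  have hmem := hf.mem
  have m1' : s(t.b, t.a) ∈ T.diagonals := by rwa [Sym2.eq_swap]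
  have m2' : s(t.c, t.b) ∈ T.diagonals := by rwa [Sym2.eq_swap]
  have m3' : s(t.a, t.c) ∈ T.diagonals := by rwa [Sym2.eq_swap]
  have b1 := Triangulation.sbtw_sub_one_of_mem m1'
  have b2 := Triangulation.sbtw_sub_one_of_mem m2'
  have b3 := Triangulation.sbtw_sub_one_of_mem m3'
  have l1 : sbtw (t.b - 1) (t.c - 1) t.c := by
    have := sbtw_sub_one_left (x := t.b) (y := t.c) (Triangulation.mem_ne m2').symm.symm
      (Triangulation.ne_sub_one_of_mem m2').1
    grind [Fin.sbtw_iff]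
  have l2 : sbtw t.c (t.a - 1) (t.b - 1) := by grind [Fin.sbtw_iff]
  -- The quadrilateral is `b - 1, c - 1, c, a - 1`. Only its side `s(c, a - 1)` needs an argument:
  -- any other apex `x` gives a diagonal `s(x, b - 1)`, and each case of `Inv.cover` turns it into a
  -- diagonal of `T` crossing `s(c, a)`.
  refine hf.eq_of_quadrilateral l1 l2 (.inr r2) (.inl (isSide_sub_one _)) ?_ (.inr r1)
  obtain ⟨x, hx, e1, e2⟩ := Triangulation.exists_apex
    (Triangulation.hasEdge_of_mem hmem).symm l2
  have hxa : x = t.a - 1 := by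
    by_contra hne
    have c1 := (Triangulation.hasEdge_of_mem r1).not_cross e1.symm
    have hx1 : sbtw t.c x (t.a - 1) := by grind [Fin.sbtw_iff]
    have hx2 : sbtw t.c x t.a := by grind [Fin.sbtw_iff]
    have hx3 : sbtw t.c (x + 1) t.a := by
      have hxc : x ≠ t.a := by rintro rfl; exact sbtw_irrefl_right hx2
      have hxa : t.a ≠ x + 1 := fun h => hne (by rw [h]; simp)
      have := sbtw_add_one (x := x) (y := t.a) hxc.symm hxa
      grind [Fin.sbtw_iff]
    have hb1 : sbtw t.a (t.b - 1) t.c := (h.ccwAt_moved ht).2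
    have hx4 : sbtw t.a t.b t.c := hcw
    have hca' := Triangulation.hasEdge_of_mem m3
    have e2m : s(x, t.b - 1) ∈ s.tri.diagonals :=
      e2.mem (k := t.a) (l := t.c) (by grind [Fin.sbtw_iff]) (by grind [Fin.sbtw_iff])
    rcases h.cover _ e2m with h1 | h1 | ⟨r, hr, h1⟩
    · exact hca'.not_cross (Triangulation.hasEdge_of_mem (h.unflipped_subset h1)) hx2 hb1
    · rw [Triangulation.mem_rotate', sub_add_cancel] at h1
      exact hca'.not_cross (Triangulation.hasEdge_of_mem h1) hx3 hx4
    · have hrm := (h.mem_diagonals hr).2.1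
      rw [h.moved_eq r hr, Sym2.eq_iff] at h1
      rcases h1 with ⟨h1, h2⟩ | ⟨h1, h2⟩
      · have h3 : r.b = x + 1 := by rw [h1]; simp
        rw [h3, ← h2] at hrm
        exact hca'.not_cross (Triangulation.hasEdge_of_mem hrm) hx3 hb1
      · have h3 : r.b = t.b := by simpa using h2.symm
        rw [h3, ← h1] at hrm
        exact hca'.not_cross (Triangulation.hasEdge_of_mem hrm).symm hx2 hx4
  rw [← hxa]
  exact e1

/-- Preservation of the invariant when the rotation of the current triangle is completed. -/
theorem flip_finish (h : Inv T s D) {t : StartedTriangle n} {e : Sym2 (Fin (n + 2))}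
    (hcur : s.current = some t) (hbc : s(t.b, t.c) ∉ s.unflipped)
    (hca : s(t.c, t.a) ∉ s.unflipped) (hf : FlipsTo s.tri t.moved e T') :
    Inv T ⟨T', s.unflipped, s.pending.head?, s.pending.tail⟩ D := by
  have he := h.finish_eq hcur hbc hca hf
  have ht := current_mem hcur
  obtain ⟨m1, m2, m3⟩ := h.mem_diagonals ht
  have hst : State.stack ⟨T', s.unflipped, s.pending.head?, s.pending.tail⟩ = s.pending := by
    unfold State.stack
    cases s.pending <;> rfl
  have hold : ∀ r ∈ s.pending, r ∈ s.stack := by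
    intro r hr
    rw [stack_eq hcur]
    exact List.mem_cons_of_mem _ hr
  have hmem : ∀ r ∈ s.stack, r ≠ t → r ∈ s.pending := by
    intro r hr hne
    rw [stack_eq hcur] at hr
    exact (List.mem_cons.1 hr).resolve_left hne
  have hne : ∀ r ∈ s.pending, r ≠ t := by
    rintro r hr rfl
    have := h.nested
    rw [stack_eq hcur] at this
    exact ((List.pairwise_cons.1 this).1 r hr).1
      (sbtw_cyclic_left (sbtw_cyclic_left (h.cw r ht)))
  constructor
  case unflipped_subset => exact h.unflipped_subset
  case unflipped_subset_tri =>
    exact fun f hfm => hf.mem_of_ne (h.unflipped_subset_tri hfm)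
      (fun heq => h.moved_notMem ht (heq ▸ h.unflipped_subset hfm))
  case cover =>
    intro f hfm
    rcases hf.eq_or_mem hfm with rfl | ⟨h1, h2⟩
    · exact .inr (.inl (he ▸ map_sub_one_mem_rotate m3))
    · rcases h.cover f h1 with h3 | h3 | ⟨r, hr, h3⟩
      · exact .inl h3
      · exact .inr (.inl h3)
      · refine .inr (.inr ⟨r, ?_, h3⟩)
        rw [hst]
        refine hmem r hr ?_
        rintro rfl
        exact h2 h3
  case started_subset => exact h.started_subset
  case cw => rw [hst]; exact fun r hr => h.cw r (hold r hr)
  case verts_mem => rw [hst]; exact fun r hr => h.verts_mem r (hold r hr)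
  case moved_eq => rw [hst]; exact fun r hr => h.moved_eq r (hold r hr)
  case moved_mem =>
    rw [hst]
    exact fun r hr => hf.mem_of_ne (h.moved_mem r (hold r hr))
      (h.moved_ne_of_current hcur (hold r hr) (hne r hr))
  case initial_notMem => rw [hst]; exact fun r hr => h.initial_notMem r (hold r hr)
  case most => rw [hst]; exact fun r hr => h.most r (hold r hr)
  case nested =>
    rw [hst]
    have := h.nested
    rw [stack_eq hcur] at this
    exact (List.pairwise_cons.1 this).2
  case flipped =>
    rw [hst]
    intro f hfT hfm
    rcases h.flipped f hfT hfm with h1 | ⟨r, hr, h1⟩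
    · refine .inl (hf.mem_of_ne h1 fun heq => ?_)
      exact h.moved_notMem_rotate ht (heq ▸ map_sub_one_mem_rotate hfT)
    · by_cases hrt : r = t
      · subst hrt
        rcases h1 with ⟨-, h1⟩ | ⟨h1, -⟩
        · exact absurd h1 hca
        · rw [h1, ← he]
          exact .inl hf.mem_new
      · exact .inr ⟨r, hmem r hr hrt, h1⟩
  case unstarted => exact h.unstarted
  case finished =>
    rw [hst]
    intro f hfD
    rcases h.finished f hfD with ⟨r, hr, h1⟩ | h1
    · by_cases hrt : r = t
      · subst hrt
        right
        have hab := h.initial_notMem r ht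
        have hab' : s(r.b, r.a) ∉ s.unflipped := by rwa [Sym2.eq_swap]
        have hbc' : s(r.c, r.b) ∉ s.unflipped := by rwa [Sym2.eq_swap]
        have hca' : s(r.a, r.c) ∉ s.unflipped := by rwa [Sym2.eq_swap]
        intro i hi j hj hij
        simp only [h1, StartedTriangle.verts, Finset.mem_insert, Finset.mem_singleton] at hi hj
        rcases hi with rfl | rfl | rfl <;> rcases hj with rfl | rfl | rfl <;> first
          | assumption
          | exact absurd rfl hij
      · exact .inl ⟨r, hmem r hr hrt, h1⟩
    · exact .inr h1
  case pending_eq =>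
    intro h1
    have : s.pending = [] := List.head?_eq_none_iff.1 h1
    simp [this]

end Inv
end PolygonFlip

namespace PolygonFlip

variable {n : ℕ}

/-! ### The moves of the procedure respect the invariant -/

theorem sbtw_of_sub_one {w b v : Fin (n + 2)} (h : sbtw w (b - 1) v) (hne : b ≠ v) :
    sbtw w b v := by
  have h1 := sbtw_sub_one_left (x := b) (y := v) hne.symm (by
    rintro rfl; exact sbtw_irrefl_right h)
  grind [Fin.sbtw_iff]

theorem not_sbtw_self_sub_one {b c : Fin (n + 2)} : ¬ sbtw b (b - 1) c := by
  intro h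
  have h1 := sbtw_sub_one_left (x := b) (y := c)
    (by rintro rfl; exact sbtw_irrefl_left_right h) (by rintro rfl; exact sbtw_irrefl_right h)
  grind [Fin.sbtw_iff]

theorem triple_eq_cases {a b c a' b' c' : Fin (n + 2)} (h : sbtw a b c) (h' : sbtw a' b' c')
    (heq : ({a, b, c} : Finset (Fin (n + 2))) = {a', b', c'}) :
    (a = a' ∧ b = b' ∧ c = c') ∨ (a = b' ∧ b = c' ∧ c = a') ∨ (a = c' ∧ b = a' ∧ c = b') := by
  have ha : a ∈ ({a', b', c'} : Finset (Fin (n + 2))) := by rw [← heq]; simp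
  have hb : b ∈ ({a', b', c'} : Finset (Fin (n + 2))) := by rw [← heq]; simp
  have hc : c ∈ ({a', b', c'} : Finset (Fin (n + 2))) := by rw [← heq]; simp
  simp only [Finset.mem_insert, Finset.mem_singleton] at ha hb hc
  clear heq
  have n1 : a ≠ b := by rintro rfl; exact sbtw_irrefl_left h
  have n2 : b ≠ c := by rintro rfl; exact sbtw_irrefl_right h
  have n3 : c ≠ a := by rintro rfl; exact sbtw_irrefl_left_right h
  rcases ha with rfl | rfl | rfl <;> rcases hb with rfl | rfl | rfl <;>
    rcases hc with rfl | rfl | rfl <;> first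
      | exact absurd rfl n1
      | exact absurd rfl n2
      | exact absurd rfl n3
      | exact .inl ⟨rfl, rfl, rfl⟩
      | exact .inr (.inl ⟨rfl, rfl, rfl⟩)
      | exact .inr (.inr ⟨rfl, rfl, rfl⟩)
      | exact absurd h (by grind [Fin.sbtw_iff])

theorem incidentCcw_mk {v x w : Fin (n + 2)} (h : sbtw w x v) : IncidentCcw s(v, x) s(v, w) :=
  ⟨v, x, w, rfl, rfl, h⟩

namespace Inv

variable {T T' : Triangulation n} {s : State n} {D : Finset (Finset (Fin (n + 2)))}
  {t : StartedTriangle n}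

theorem incidentCcw_of_unstarted (h : Inv T s D) {r : Finset (Fin (n + 2))}
    (hr : r ∈ T.internalTriangles) (hrD : r ∉ D) {i j : Fin (n + 2)} (hi : i ∈ r) (hj : j ∈ r)
    (hij : i ≠ j) : ∃ f ∈ s.unflipped, IncidentCcw f s(i, j) := by
  obtain ⟨k, -, ⟨-, h1, h2⟩ | ⟨-, h1, h2⟩⟩ := h.blocked_of_unstarted hr hrD hi hj hij
  · exact ⟨_, h1, incidentCcw_mk h2⟩
  · exact ⟨_, h1, by rw [Sym2.eq_swap (a := i)]; exact incidentCcw_mk h2⟩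

/-- A free diagonal is neither a side of an unstarted triangle, where the sides block each other,
nor the third side of a triangle under rotation, which the temporary diagonal blocks. So it simply
rotates. -/
theorem step_free (h : Inv T s D) {d e : Sym2 (Fin (n + 2))} (hd : s.IsFree d)
    (hf : FlipsTo s.tri d e T') :
    Inv T ⟨T', s.unflipped.erase d, s.current, s.pending⟩ D := by
  induction d with | _ i j =>
  have he : e = s(i, j).map (· - 1) := hf.eq_rotate
    (fun x hx hs => hd.2 _ hx (incidentCcw_mk hs))
    (fun x hx hs => hd.2 _ hx (by rw [Sym2.eq_swap (a := i)]; exact incidentCcw_mk hs))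
  subst he
  refine h.flip_rotate hd.1 hf ?_ ?_
  · intro r hr hrD p hp q hq hpq heq
    obtain ⟨f, hf1, hf2⟩ := h.incidentCcw_of_unstarted hr hrD hp hq hpq
    rw [heq] at hf2
    exact hd.2 f (h.unflipped_subset_tri hf1) hf2
  · intro r hr heq
    obtain ⟨h1, h2⟩ := h.ccwAt_moved hr
    have := incidentCcw_mk h2
    rw [heq] at this
    exact hd.2 _ h1 this

/-- The temporary diagonal is not counterclockwise to the second side, so the exemption in the rule
matters only for the third side. -/
theorem isFree_of_side (h : Inv T s D) (hcur : s.current = some t)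
    (hd : s(t.b, t.c) ∈ s.unflipped)
    (hccw : ∀ f ∈ s.tri.diagonals, IncidentCcw f s(t.b, t.c) → f = t.moved) :
    s.IsFree s(t.b, t.c) := by
  have ht := current_mem hcur
  refine ⟨hd, fun f hf hc => ?_⟩
  have hm := hccw f hf hc
  obtain ⟨v, x, w, rfl, h1, h2⟩ := hc
  rw [Sym2.eq_iff] at h1
  rcases h1 with ⟨rfl, rfl⟩ | ⟨rfl, rfl⟩
  · exact h.second_unblocked ht x hf h2
  · rw [h.moved_eq t ht, Sym2.eq_iff] at hm
    rcases hm with ⟨h3, h4⟩ | ⟨h3, h4⟩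
    · exact (Triangulation.ne_sub_one_of_mem (h.mem_diagonals ht).2.1).2 h3
    · rw [h4] at h2
      exact not_sbtw_self_sub_one h2

/-- With only the temporary diagonal in the way, the quadrilateral around `s(c, a)` is `c, a - 1, a,
b - 1`, so the flip produces the rotation of the initial side. -/
theorem step_third (h : Inv T s D) {e : Sym2 (Fin (n + 2))} (hcur : s.current = some t)
    (hd : s(t.c, t.a) ∈ s.unflipped)
    (hccw : ∀ f ∈ s.tri.diagonals, IncidentCcw f s(t.c, t.a) → f = t.moved)
    (hf : FlipsTo s.tri s(t.c, t.a) e T') :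
    Inv T ⟨T', s.unflipped.erase s(t.c, t.a), s.current, s.pending⟩ D := by
  have ht := current_mem hcur
  obtain ⟨m1, m2, m3⟩ := h.mem_diagonals ht
  have hcw := h.cw t ht
  have hmoved := h.ccwAt_moved ht
  have hdt := h.unflipped_subset_tri hd
  have hdt' : s(t.a, t.c) ∈ s.tri.diagonals := by rwa [Sym2.eq_swap]
  have he : e = s(t.a - 1, t.b - 1) := by
    have l1 : sbtw t.c (t.a - 1) t.a := Triangulation.sbtw_sub_one_of_mem hdt'
    refine hf.eq_of_quadrilateral l1 hmoved.2 (Triangulation.hasEdge_sub_one hdt' ?_)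
      (.inl (isSide_sub_one _)) ?_ (Triangulation.hasEdge_of_mem hmoved.1).symm
    · intro x hx hs
      have := hccw _ hx (by rw [Sym2.eq_swap (a := t.c)]; exact incidentCcw_mk hs)
      rw [h.moved_eq t ht, Sym2.eq_iff] at this
      rcases this with ⟨h1, -⟩ | ⟨h1, -⟩
      · exact (Triangulation.ne_sub_one_of_mem m1).1 h1
      · exact Triangulation.mem_ne m3 h1.symm
    · obtain ⟨x, hx, e1, e2⟩ :=
        Triangulation.exists_apex (Triangulation.hasEdge_of_mem hdt') hmoved.2
      have hxb : x = t.b - 1 := by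
        rcases e2 with (h1 | h1) | h1
        · exfalso
          have hne1 : t.b ≠ x := by
            rintro rfl
            exact (Triangulation.ne_add_one_of_mem m2).1 h1
          have hx1 : sbtw t.b x t.c := by
            have hxc : x = t.c - 1 := by rw [h1]; simp
            rw [hxc]
            refine Triangulation.sbtw_sub_one_of_mem (S := T) ?_
            rwa [Sym2.eq_swap]
          have hb := sbtw_sub_one_left (x := t.b) (y := x) hne1.symm (by
            rintro rfl; exact not_sbtw_self_sub_one hx1)
          refine e1.not_cross (j := t.b - 1) (l := t.c)
            (Triangulation.hasEdge_of_mem hmoved.1).symm ?_ ?_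
          · have := Triangulation.sbtw_sub_one_of_mem (S := T) (i := t.b) (j := t.a)
              (by rwa [Sym2.eq_swap])
            grind [Fin.sbtw_iff]
          · grind [Fin.sbtw_iff]
        · exfalso
          have := sbtw_add_one (x := t.c) (y := t.a) (Triangulation.mem_ne m3).symm
            (Triangulation.ne_add_one_of_mem m3).1
          rw [← h1] at this
          grind [Fin.sbtw_iff]
        · rw [Sym2.eq_swap] at h1
          have := hccw _ h1 (incidentCcw_mk hx)
          rw [h.moved_eq t ht, Sym2.eq_iff] at this
          rcases this with ⟨h1, -⟩ | ⟨-, h1⟩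
          · exact absurd h1 (Triangulation.ne_sub_one_of_mem m2).2
          · exact h1
      rw [← hxb]
      exact e1
  subst he
  refine h.flip_third ht hd hf ?_ ?_
  · intro r hr hrD i hi j hj hij heq
    obtain ⟨f, hf1, hf2⟩ := h.incidentCcw_of_unstarted hr hrD hi hj hij
    rw [heq] at hf2
    have := hccw f (h.unflipped_subset_tri hf1) hf2
    exact h.moved_notMem ht (this ▸ h.unflipped_subset hf1)
  · intro r hr hne heq
    have h1 := h.ne_of_current hcur hr hne
    rw [Sym2.eq_iff] at heq
    tauto

/-- Where the obstacles of the second and the third side of the current triangle are. -/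
theorem obstacle_cases (h : Inv T s D) (ht : t ∈ s.stack) {v w x : Fin (n + 2)}
    (hside : t.IsOtherSide s(v, w)) (hx : sbtw w x v) (hvx : s(v, x) ∈ s.unflipped) :
    (v = t.c ∧ sbtw t.b x t.c) ∨ (v = t.a ∧ sbtw t.c x t.a) ∨ (v = t.c ∧ x = t.b) := by
  obtain ⟨m1, m2, m3⟩ := h.mem_diagonals ht
  have hcw := h.cw t ht
  rcases hside with h1 | h1 <;> rw [Sym2.eq_iff] at h1 <;> rcases h1 with ⟨rfl, rfl⟩ | ⟨rfl, rfl⟩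
  · exact absurd hx (h.second_unblocked ht x (h.unflipped_subset_tri hvx))
  · exact .inl ⟨rfl, hx⟩
  · exact .inr (.inl ⟨rfl, hx⟩)
  · have := (Triangulation.hasEdge_of_mem m1).not_cross
      (Triangulation.hasEdge_of_mem (h.unflipped_subset hvx)).symm
    by_cases hxb : x = t.b
    · exact .inr (.inr ⟨rfl, hxb⟩)
    · exact .inl ⟨rfl, by grind [Fin.sbtw_iff]⟩

/-- The exempted diagonal is never beyond an unflipped obstacle; so an obstacle that is
counterclockwise-most up to the exemption is so without it. -/
theorem moved_not_ccw (h : Inv T s D) (ht : t ∈ s.stack) {v w x z : Fin (n + 2)}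
    (hside : t.IsOtherSide s(v, w)) (hx : sbtw w x v) (hvx : s(v, x) ∈ s.unflipped)
    (hz : s(v, z) = t.moved) : ¬ sbtw x z v := by
  obtain ⟨m1, m2, m3⟩ := h.mem_diagonals ht
  rw [h.moved_eq t ht, Sym2.eq_iff] at hz
  rcases h.obstacle_cases ht hside hx hvx with ⟨rfl, h1⟩ | ⟨rfl, h1⟩ | ⟨rfl, rfl⟩
  · rcases hz with ⟨h2, -⟩ | ⟨-, rfl⟩
    · exact absurd h2 (Triangulation.ne_sub_one_of_mem m2).2
    · intro h2
      exact not_sbtw_self_sub_one (b := t.b) (c := t.c) (by grind [Fin.sbtw_iff])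
  · rcases hz with ⟨h2, -⟩ | ⟨h2, -⟩
    · exact absurd h2 (Triangulation.ne_sub_one_of_mem m1).1
    · exact absurd h2 (Triangulation.mem_ne m3).symm
  · rcases hz with ⟨h2, -⟩ | ⟨-, rfl⟩
    · exact absurd h2 (Triangulation.ne_sub_one_of_mem m2).2
    · exact not_sbtw_self_sub_one

theorem step_obstacle (h : Inv T s D) {v w x y : Fin (n + 2)} {e : Sym2 (Fin (n + 2))}
    (hcur : s.current = some t) (hfree : ∀ d, ¬ s.IsFree d)
    (hside : t.IsOtherSide s(v, w)) (hx : sbtw w x v) (hvx : s(v, x) ∈ s.unflipped)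
    (hmost : ∀ z, s(v, z) ∈ s.tri.diagonals → s(v, z) ≠ t.moved → ¬ sbtw x z v)
    (hxvy : sbtw x v y) (hint : {x, v, y} ∈ T.internalTriangles)
    (hf : FlipsTo s.tri s(v, x) e T') :
    {x, v, y} ∉ D ∧ Inv T ⟨T', s.unflipped.erase s(v, x), s.current, ⟨x, v, y, e⟩ :: s.pending⟩
      (insert {x, v, y} D) := by
  have ht := current_mem hcur
  obtain ⟨m1, m2, m3⟩ := h.mem_diagonals ht
  have hcw := h.cw t ht
  have hcases := h.obstacle_cases ht hside hx hvx
  have hb : ∀ z, s(v, z) ∈ s.tri.diagonals → ¬ sbtw x z v := by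
    intro z hz
    by_cases hzm : s(v, z) = t.moved
    · exact h.moved_not_ccw ht hside hx hvx hzm
    · exact hmost z hz hzm
  have hv : v = t.c ∨ v = t.a := by tauto
  have hxv' : s(x, v) ∈ s.unflipped := by rwa [Sym2.eq_swap]
  have hthird : ∀ r ∈ s.stack, ¬ (x = r.c ∧ v = r.a) := by
    rintro r hr ⟨h1, h2⟩
    by_cases hrt : r = t
    · subst hrt
      rcases hcases with ⟨h3, h4⟩ | ⟨h3, h4⟩ | ⟨h3, h4⟩
      · exact Triangulation.mem_ne m3 (by rw [← h3, ← h2])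
      · rw [h1] at h4
        exact sbtw_irrefl_left h4
      · exact Triangulation.mem_ne m3 (by rw [← h3, ← h2])
    · have := h.ne_of_current hcur hr hrt
      rcases hv with h3 | h3
      · exact this.2.2 (h2.symm.trans h3)
      · exact this.1 (h2.symm.trans h3)
  -- If the triangle had been started, the unflipped `s(x, v)` would leave it on the stack. There it
  -- cannot be the initial side, which is flipped, nor the second side, which would be free, nor the
  -- third side, by `hthird`.
  have hD : {x, v, y} ∉ D := by
    intro hD
    rcases h.finished _ hD with ⟨r, hr, h1⟩ | h1
    · rcases triple_eq_cases hxvy (h.cw r hr) h1 with ⟨h2, h3, h4⟩ | ⟨h2, h3, h4⟩ | ⟨h2, h3, h4⟩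
      · rw [h2, h3] at hxv'
        exact h.initial_notMem r hr hxv'
      · refine hfree s(x, v) ⟨hxv', fun f hf hc => ?_⟩
        obtain ⟨v', x', w', rfl, h5, h6⟩ := hc
        rw [Sym2.eq_iff] at h5
        rcases h5 with ⟨rfl, rfl⟩ | ⟨rfl, rfl⟩
        · rw [h2] at hf h6
          rw [h3] at h6
          exact h.second_unblocked hr x' hf h6
        · exact hb x' hf h6
      · exact hthird r hr ⟨h2, h3⟩
    · refine h1 x (by simp) v (by simp) ?_ hxv'
      rintro rfl
      exact sbtw_irrefl_left hxvy
  refine ⟨hD, ?_⟩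
  obtain ⟨f1, f2, f3⟩ := (Triangulation.mem_internalTriangles hxvy).1 hint
  have f1 := Triangulation.hasEdge_of_mem f1
  have f2 := Triangulation.hasEdge_of_mem f2
  have f3 := Triangulation.hasEdge_of_mem f3
  have hne : ¬ (v = t.c ∧ x = t.b) := by
    rintro ⟨rfl, rfl⟩
    have hy : y = t.a := by
      refine Triangulation.apex_unique (T := T) (i := t.c) (j := t.b) (sbtw_cyclic_left hxvy)
        (sbtw_cyclic_left (sbtw_cyclic_left hcw)) f2 f3 (Triangulation.hasEdge_of_mem m3)
        (Triangulation.hasEdge_of_mem m1)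
    refine hD ?_
    rw [hy, ← triple_rotate]
    exact h.verts_mem t ht
  have hpos : (v = t.c ∧ sbtw t.b x t.c ∧ ¬ sbtw t.c y t.b) ∨
      (v = t.a ∧ sbtw t.c x t.a ∧ ¬ sbtw t.a y t.c) := by
    rcases hcases with ⟨h1, h2⟩ | ⟨h1, h2⟩ | h1
    · exact .inl ⟨h1, h2, (Triangulation.hasEdge_of_mem m2).not_cross f3.symm h2⟩
    · exact .inr ⟨h1, h2, (Triangulation.hasEdge_of_mem m3).not_cross f3.symm h2⟩
    · exact absurd h1 hne
  have hst : State.stack ⟨T', s.unflipped.erase s(v, x), s.current, ⟨x, v, y, e⟩ :: s.pending⟩ =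
      t :: ⟨x, v, y, e⟩ :: s.pending := by
    unfold State.stack
    rw [hcur]
    rfl
  refine h.flip_initial hxvy hint hD hb ?_ (e := e) ?_ ?_ ?_ ?_ ?_
  · intro r hr heq
    rw [Sym2.eq_iff] at heq
    rcases heq with ⟨h1, h2⟩ | ⟨h1, h2⟩
    · exact hthird r hr ⟨h1.symm, h2.symm⟩
    · obtain ⟨h3, h4⟩ := h.ccwAt_moved hr
      rw [h1] at h3 h4
      rw [h2] at h4
      exact hb _ h3 h4
  · rw [Sym2.eq_swap]
    exact hf
  · rw [Sym2.eq_swap]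
  · intro r
    rw [stack_eq hcur, hst]
    simp only [List.mem_cons]
    tauto
  · rw [hst]
    have hnest := h.nested
    rw [stack_eq hcur] at hnest
    obtain ⟨hn1, hn2⟩ := List.pairwise_cons.1 hnest
    refine List.pairwise_cons.2 ⟨?_, List.pairwise_cons.2 ⟨?_, hn2⟩⟩
    · intro r hr
      rcases List.mem_cons.1 hr with rfl | hr
      · unfold StartedTriangle.Beyond
        dsimp only
        clear hb hthird hfree hmost hn1 hn2 hnest f1 f2 f3 m1 m2 m3 hcases hv hint hD hf hside
        rcases hpos with ⟨rfl, h1, h2⟩ | ⟨rfl, h1, h2⟩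
        · grind [Fin.sbtw_iff]
        · grind [Fin.sbtw_iff]
      · exact hn1 r hr
    · intro r hr
      have hrs : r ∈ s.stack := by rw [stack_eq hcur]; exact List.mem_cons_of_mem _ hr
      obtain ⟨b1, b2, b3⟩ := hn1 r hr
      obtain ⟨q1, q2, q3⟩ := h.mem_diagonals hrs
      have q1 := Triangulation.hasEdge_of_mem q1
      have q2 := Triangulation.hasEdge_of_mem q2
      have q3 := Triangulation.hasEdge_of_mem q3
      have hrcw := h.cw r hrs
      have hini := h.initial_notMem r hrs
      have hrmost : v = r.b → ¬ sbtw r.a x r.b := by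
        rintro rfl
        exact h.most r hrs x hvx
      have hrne : ¬ (v = r.b ∧ x = r.a) := by
        rintro ⟨rfl, rfl⟩
        exact hini hxv'
      have c1 := q2.symm.not_cross f1
      have c2 := q3.not_cross f1
      -- As `v` is a vertex of the current triangle, `s(x, v)` could leave the region beyond `s(r.b,
      -- r.c)` only at one of its ends. At `r.b` this is excluded by `most`, `initial_notMem` and
      -- the side `s(r.c, r.a)`; at `r.c` by the position of `x` relative to the current triangle.
      have hxin : ¬ sbtw r.c x r.b := by
        clear hb hthird hfree hmost hn1 hn2 hnest f1 f2 f3 m1 m2 m3 hcases hv hint hD hf hside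
          q1 q2 q3
        rcases hpos with ⟨rfl, h1, h2⟩ | ⟨rfl, h1, h2⟩
        · grind [Fin.sbtw_iff]
        · grind [Fin.sbtw_iff]
      have c3 := q2.symm.not_cross f3
      have c4 := q2.symm.not_cross f2.symm
      clear hb hthird hfree hmost hn1 hn2 hnest f1 f2 f3 m1 m2 m3 hcases hv hint hD hf hside
        q1 q2 q3 c1 c2
      unfold StartedTriangle.Beyond
      dsimp only
      rcases hpos with ⟨rfl, h1, h2⟩ | ⟨rfl, h1, h2⟩
      · refine ⟨hxin, b3, ?_⟩
        grind [Fin.sbtw_iff]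
      · refine ⟨hxin, b1, ?_⟩
        grind [Fin.sbtw_iff]
  · intro h1
    exact absurd (h1.symm.trans hcur) (by simp)

/-- Every flip of the procedure preserves the invariant. -/
theorem step (h : Inv T s D) {s' : State n} (hs : Step T s s') :
    ∃ D', Inv T s' D' ∧ s'.unflipped.card + s'.stack.length + 1 + D.card =
      s.unflipped.card + s.stack.length + D'.card := by
  cases hs with
  | free d e T' hd hf =>
    refine ⟨D, h.step_free hd hf, ?_⟩
    have := Finset.card_erase_add_one hd.1
    simp only [State.stack]
    omega
  | start a b c e T' hcur hfree habc hint hab hb hf =>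
    have hp := h.pending_eq hcur
    have hst : s.stack = [] := by unfold State.stack; rw [hcur, hp]; rfl
    have hD : {a, b, c} ∉ D := by
      intro hD
      rcases h.finished _ hD with ⟨r, hr, -⟩ | h1
      · rw [hst] at hr
        exact absurd hr List.not_mem_nil
      · refine h1 a (by simp) b (by simp) ?_ hab
        rintro rfl
        exact sbtw_irrefl_left habc
    refine ⟨insert {a, b, c} D, h.flip_initial habc hint hD hb ?_ hf rfl ?_ ?_ ?_, ?_⟩
    · rw [hst]
      exact fun r hr => absurd hr List.not_mem_nil
    · intro r
      rw [hst]
      simp [State.stack, hp]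
    · simp [State.stack, hp]
    · intro h1
      exact absurd h1 (by simp)
    · have := Finset.card_erase_add_one hab
      rw [Finset.card_insert_of_notMem hD, hst]
      simp only [State.stack, hp, Option.toList_some, List.append_nil, List.length_singleton,
        List.length_nil]
      omega
  | obstacle t v w x y e T' hcur hfree hside hvw hx hvx hmost hxvy hint hf =>
    obtain ⟨hD, hI⟩ := h.step_obstacle hcur hfree hside hx hvx hmost hxvy hint hf
    refine ⟨_, hI, ?_⟩
    have := Finset.card_erase_add_one hvx
    rw [Finset.card_insert_of_notMem hD]
    simp only [State.stack, List.length_append, List.length_cons]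
    omega
  | side t d e T' hcur hside hd hccw hf =>
    refine ⟨D, ?_, ?_⟩
    · rcases hside with rfl | rfl
      · exact h.step_free (h.isFree_of_side hcur hd hccw) hf
      · rw [Sym2.eq_swap] at hd hccw hf ⊢
        exact h.step_third hcur hd hccw hf
    · have := Finset.card_erase_add_one hd
      simp only [State.stack]
      omega
  | finish t e T' hcur hside hf =>
    have hbc := hside _ (.inl rfl)
    have hca := hside _ (.inr rfl)
    rw [Sym2.eq_swap] at hca
    refine ⟨D, h.flip_finish hcur hbc hca hf, ?_⟩
    rw [stack_eq hcur]
    unfold State.stack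
    dsimp only
    cases s.pending <;> simp +arith

/-! ### Progress: the procedure does not get stuck -/

/-- A counterclockwise-most obstacle belongs to an internal triangle. -/
theorem exists_internal (h : Inv T s D) (hfree : ∀ d, ¬ s.IsFree d) {v w z : Fin (n + 2)}
    (hvw : s(v, w) ∈ T.diagonals) (hvz : s(v, z) ∈ s.unflipped) (hz : sbtw w z v)
    (hmost : ∀ u, s(v, u) ∈ s.tri.diagonals → ¬ sbtw z u v)
    (hst : ∀ r ∈ s.stack, r.c = z → ¬ sbtw v (r.b - 1) z) :
    ∃ y, sbtw z v y ∧ {z, v, y} ∈ T.internalTriangles := by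
  have hvzT := h.unflipped_subset hvz
  have hzvT : s(z, v) ∈ T.diagonals := by rwa [Sym2.eq_swap]
  -- The obstacle `s(v, z)` is not free but unblocked at `v`, so it is blocked at `z`. The triangle
  -- of `T` over it, on the side of `w` and `u`, has no polygon side: `s(v, w)` and `s(z, u)`
  -- prevent this at `v` and at `z`.
  obtain ⟨u, hu, huv⟩ : ∃ u, s(z, u) ∈ T.diagonals ∧ sbtw v u z := by
    by_contra hno
    refine hfree _ ⟨hvz, fun f hf hc => ?_⟩
    obtain ⟨v', u, w', rfl, h1, h2⟩ := hc
    rw [Sym2.eq_iff] at h1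
    rcases h1 with ⟨rfl, rfl⟩ | ⟨rfl, rfl⟩
    · exact hmost u hf h2
    · rcases h.blocker hzvT hf h2 with h3 | ⟨r, hr, h3, rfl⟩
      · exact hno ⟨u, h.unflipped_subset h3, h2⟩
      · exact hst r hr h3 h2
  obtain ⟨y, hy, e1, e2⟩ := Triangulation.exists_apex (Triangulation.hasEdge_of_mem hvzT) huv
  have c1 := e2.not_cross (Triangulation.hasEdge_of_mem hvw).symm
  have c2 := e1.not_cross (Triangulation.hasEdge_of_mem hu).symm
  have hzvy : sbtw z v y := by grind [Fin.sbtw_iff]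
  refine ⟨y, hzvy, (Triangulation.mem_internalTriangles hzvy).2 ⟨hzvT, ?_, ?_⟩⟩
  · by_cases hwy : w = y
    · rwa [← hwy]
    · exact e1.mem (k := w) (l := z) (by grind [Fin.sbtw_iff]) (by grind [Fin.sbtw_iff])
  · by_cases huy : u = y
    · rwa [← huy, Sym2.eq_swap]
    · exact e2.mem (k := u) (l := v) (by grind [Fin.sbtw_iff]) (by grind [Fin.sbtw_iff])

theorem exists_most {P : Fin (n + 2) → Prop} {v w x : Fin (n + 2)} (hx : P x)
    (hwx : sbtw w x v) : ∃ z, P z ∧ sbtw w z v ∧ ∀ u, P u → ¬ sbtw z u v := by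
  classical
  obtain ⟨z, hz, hmin⟩ := Finset.exists_min_image
    (Finset.univ.filter fun z => P z ∧ sbtw w z v) (fun z => (v - z).val)
    ⟨x, by simpa using ⟨hx, hwx⟩⟩
  simp only [Finset.mem_filter, Finset.mem_univ, true_and] at hz hmin
  refine ⟨z, hz.1, hz.2, fun u hu hzu => ?_⟩
  have h1 := hz.2
  exact absurd (hmin u ⟨hu, by grind [Fin.sbtw_iff]⟩) (not_le.2 (val_sub_lt_of_sbtw' hzu))

/-- The procedure does not stop before everything has been rotated. -/
theorem exists_step (h : Inv T s D) (hs : s.current ≠ none ∨ s.unflipped.Nonempty) :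
    ∃ s', Step T s s' := by
  by_cases hfree : ∃ d, s.IsFree d
  · obtain ⟨d, hd⟩ := hfree
    obtain ⟨e, T', hf⟩ := Triangulation.exists_flipsTo (h.unflipped_subset_tri hd.1)
    exact ⟨_, .free s d e T' hd hf⟩
  push Not at hfree
  rcases hcur : s.current with _ | t
  · have hst : s.stack = [] := by unfold State.stack; rw [hcur, h.pending_eq hcur]; rfl
    obtain ⟨d, hd⟩ := hs.resolve_left (fun h => h hcur)
    have := hfree d
    obtain ⟨f, hf, v, x, w, rfl, rfl, hx⟩ : ∃ f ∈ s.tri.diagonals, IncidentCcw f d := by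
      by_contra hno
      push Not at hno
      exact this ⟨hd, hno⟩
    obtain ⟨z, hz, hwz, hmost⟩ := exists_most (P := fun z => s(v, z) ∈ s.tri.diagonals) hf hx
    have hdT := h.unflipped_subset hd
    have hvz : s(v, z) ∈ s.unflipped := by
      rcases h.blocker hdT hz hwz with h1 | ⟨r, hr, -⟩
      · exact h1
      · rw [hst] at hr
        exact absurd hr List.not_mem_nil
    obtain ⟨y, hy1, hy2⟩ := h.exists_internal hfree hdT hvz hwz hmost (by
      rw [hst]
      exact fun r hr => absurd hr List.not_mem_nil)
    have hzv : s(z, v) ∈ s.unflipped := by rwa [Sym2.eq_swap]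
    obtain ⟨e, T', hf⟩ := Triangulation.exists_flipsTo (h.unflipped_subset_tri hzv)
    exact ⟨_, .start s z v y e T' hcur hfree hy1 hy2 hzv hmost hf⟩
  · have ht := current_mem hcur
    by_cases hfin : ∀ d, t.IsOtherSide d → d ∉ s.unflipped
    · obtain ⟨e, T', hf⟩ := Triangulation.exists_flipsTo (h.moved_mem t ht)
      exact ⟨_, .finish s t e T' hcur hfin hf⟩
    push Not at hfin
    obtain ⟨d, hside, hd⟩ := hfin
    by_cases hccw : ∀ f ∈ s.tri.diagonals, IncidentCcw f d → f = t.moved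
    · obtain ⟨e, T', hf⟩ := Triangulation.exists_flipsTo (h.unflipped_subset_tri hd)
      exact ⟨_, .side s t d e T' hcur hside hd hccw hf⟩
    push Not at hccw
    obtain ⟨f, hf, ⟨v, x, w, rfl, rfl, hx⟩, hfm⟩ := hccw
    obtain ⟨z, ⟨hz, hzm⟩, hwz, hmost⟩ := exists_most
      (P := fun z => s(v, z) ∈ s.tri.diagonals ∧ s(v, z) ≠ t.moved) ⟨hf, hfm⟩ hx
    have hdT := h.unflipped_subset hd
    have hvwt : (v = t.a ∨ v = t.b ∨ v = t.c) ∧ (w = t.a ∨ w = t.b ∨ w = t.c) := by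
      rcases hside with h1 | h1 <;> rw [Sym2.eq_iff] at h1 <;> tauto
    -- Otherwise the obstacle is the temporary diagonal of a pending triangle `r`, which would put
    -- the vertex `w` of the current triangle on the wrong side of `s(r.b, r.c)`.
    have hvz : s(v, z) ∈ s.unflipped := by
      rcases h.blocker hdT hz hwz with h1 | ⟨r, hr, h1, h2⟩
      · exact h1
      · exfalso
        by_cases hrt : r = t
        · subst hrt
          rw [h.moved_eq r ht, h2, ← h1, Sym2.eq_swap] at hzm
          exact hzm rfl
        · obtain ⟨b1, b2, b3⟩ := h.current_beyond hcur hr hrt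
          rw [h2] at hwz
          have h3 := sbtw_of_sub_one hwz (fun h' =>
            Triangulation.mem_ne (h.mem_diagonals hr).2.1 (h'.trans h1.symm))
          rw [← h1] at h3
          have h4 : sbtw r.c w r.b := sbtw_cyclic_left (sbtw_cyclic_left h3)
          rcases hvwt.2 with rfl | rfl | rfl
          · exact b1 h4
          · exact b2 h4
          · exact b3 h4
    have hmost' : ∀ u, s(v, u) ∈ s.tri.diagonals → ¬ sbtw z u v := by
      intro u hu
      by_cases hum : s(v, u) = t.moved
      · exact h.moved_not_ccw ht hside hwz hvz hum
      · exact hmost u ⟨hu, hum⟩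
    obtain ⟨y, hy1, hy2⟩ := h.exists_internal hfree hdT hvz hwz hmost' (by
      intro r hr h1 h2
      by_cases hrt : r = t
      · subst hrt
        rcases h.obstacle_cases ht hside hwz hvz with ⟨rfl, h3⟩ | ⟨rfl, h3⟩ | ⟨rfl, h3⟩
        · rw [← h1] at h3
          exact sbtw_irrefl_right h3
        · rw [← h1] at h3
          exact sbtw_irrefl_left h3
        · rw [← h1] at h2
          exact sbtw_irrefl_left_right h2
      · obtain ⟨b1, b2, b3⟩ := h.current_beyond hcur hr hrt
        have h3 := sbtw_of_sub_one h2 (fun h' =>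
          Triangulation.mem_ne (h.mem_diagonals hr).2.1 (h'.trans h1.symm))
        rw [← h1] at h3
        have h4 : sbtw r.c v r.b := sbtw_cyclic_left (sbtw_cyclic_left h3)
        rcases hvwt.1 with rfl | rfl | rfl
        · exact b1 h4
        · exact b2 h4
        · exact b3 h4)
    obtain ⟨e, T', hf⟩ := Triangulation.exists_flipsTo (h.unflipped_subset_tri hvz)
    exact ⟨_, .obstacle s t v w z y e T' hcur hfree hside hd hwz hvz
      (fun u hu hum => hmost u ⟨hu, hum⟩) hy1 hy2 hf⟩

end Inv

/-! ### The balance of flips and the end of the procedure -/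

theorem Triangulation.eq_of_subset {S S' : Triangulation n}
    (h : S.diagonals ⊆ S'.diagonals) : S = S' := by
  refine Triangulation.ext (h.antisymm fun d hd => S.maximal d (S'.isDiagonal d hd) ?_)
  exact fun e he => S'.noncrossing d hd e (h he)

theorem Step.adj {T : Triangulation n} {s s' : State n} (h : Step T s s') :
    (flipGraph n).Adj s.tri s'.tri := by
  cases h with
  | free d e T' hd hf => exact ⟨_, _, hf⟩
  | start a b c e T' _ _ _ _ _ _ hf => exact ⟨_, _, hf⟩
  | obstacle t v w x y e T' _ _ _ _ _ _ _ _ _ hf => exact ⟨_, _, hf⟩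
  | side t d e T' _ _ _ _ hf => exact ⟨_, _, hf⟩
  | finish t e T' _ _ hf => exact ⟨_, _, hf⟩

section
variable {T : Triangulation n} {s : State n}

/-- Each first flip of a diagonal uses up an unflipped one; starting a triangle adds one to the
stack and one to `D`, and a finishing flip is paid for by the stack. -/
theorem Run.exists_inv {p : (flipGraph n).Walk T s.tri} (h : Run T s p) :
    ∃ D, Inv T s D ∧
      p.length + s.unflipped.card + s.stack.length = T.diagonals.card + D.card := by
  induction h with
  | nil => exact ⟨∅, Inv.initial T, by simp [State.init, State.stack]⟩
  | snoc s s' p hp hs hadj ih =>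
    obtain ⟨D, hI, hc⟩ := ih
    obtain ⟨D', hI', hc'⟩ := hI.step hs
    refine ⟨D', hI', ?_⟩
    rw [SimpleGraph.Walk.length_concat]
    omega

theorem Run.length_le {p : (flipGraph n).Walk T s.tri} (h : Run T s p) :
    p.length ≤ n - 1 + T.internalTriangles.card := by
  obtain ⟨D, hI, hc⟩ := h.exists_inv
  have := Finset.card_le_card hI.started_subset
  rw [T.card_diagonals] at hc
  omega

theorem Run.tri_eq {p : (flipGraph n).Walk T s.tri} (h : Run T s p) (hs : Stops T s) :
    s.tri = T.rotate := by
  obtain ⟨D, hI, -⟩ := h.exists_inv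
  have hno : ¬ (s.current ≠ none ∨ s.unflipped.Nonempty) := fun h' =>
    let ⟨s', hs'⟩ := hI.exists_step h'
    hs s' hs'
  rw [not_or, not_not, Finset.not_nonempty_iff_eq_empty] at hno
  refine Triangulation.eq_of_subset fun d hd => ?_
  rcases hI.cover d hd with h1 | h1 | ⟨r, hr, -⟩
  · rw [hno.2] at h1
    exact absurd h1 (Finset.notMem_empty _)
  · exact h1
  · rw [State.stack, hno.1, hI.pending_eq hno.1] at hr
    exact absurd hr List.not_mem_nil

theorem Run.le_length {p : (flipGraph n).Walk T s.tri} (h : Run T s p) (hs : Stops T s) :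
    n - 1 + T.internalTriangles.card ≤ p.length := by
  have := le_length_of_walk (p.copy rfl (h.tri_eq hs))
  rwa [SimpleGraph.Walk.length_copy] at this

/-- Since `Run.length_le` bounds every run, extending a run arbitrarily must end. -/
theorem Run.exists_stops {p : (flipGraph n).Walk T s.tri} (h : Run T s p) :
    ∃ (s' : State n) (q : (flipGraph n).Walk T s'.tri), Run T s' q ∧ Stops T s' := by
  induction hm : n - 1 + T.internalTriangles.card - p.length using Nat.strong_induction_on
    generalizing s with | _ m ih =>
  by_cases hs : Stops T s
  · exact ⟨s, p, h, hs⟩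
  · unfold Stops at hs
    push Not at hs
    obtain ⟨s', hs'⟩ := hs
    have h' := Run.snoc s s' p h hs' hs'.adj
    refine ih _ ?_ h' rfl
    have := h'.length_le
    rw [SimpleGraph.Walk.length_concat] at this ⊢
    omega

end

end PolygonFlip

open PolygonFlip in
theorem mainTheorem8 (n : ℕ) (hn : 1 ≤ n) (T : Triangulation n) :
    (flipGraph n).edist T T.rotate = ((n - 1 + T.internalTriangles.card : ℕ) : ℕ∞) ∧
    (∃ (s : State n) (p : (flipGraph n).Walk T s.tri), Run T s p ∧ Stops T s) ∧
    (∀ (s : State n) (p : (flipGraph n).Walk T s.tri), Run T s p →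
      p.length ≤ n - 1 + T.internalTriangles.card ∧
      (Stops T s → s.tri = T.rotate ∧ p.length = n - 1 + T.internalTriangles.card)) := by
  obtain ⟨s, p, hp, hs⟩ := (Run.nil (T := T)).exists_stops
  refine ⟨le_antisymm ?_ ?_, ⟨s, p, hp, hs⟩, fun s p hp => ⟨hp.length_le, fun hs =>
    ⟨hp.tri_eq hs, le_antisymm hp.length_le (hp.le_length hs)⟩⟩⟩
  · rw [← hp.tri_eq hs]
    exact (SimpleGraph.edist_le p).trans (by exact_mod_cast hp.length_le)
  · refine le_iInf fun q => ?_
    exact_mod_cast le_length_of_walk q
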